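/- Fix $\theta>0$. For $n\ge 1$ let $\nu_n$ be the Ewens probability measure on the symmetric group $S_n$, $\nu_n(A)=\frac{1}{\theta(\theta+1)\cdots(\theta+n-1)}\sum_{\sigma\in A}\theta^{w(\sigma)}$, where $w(\sigma)$ is the number of cycles of $\sigma$ (fixed points included), and let $k_j(\sigma)$ be the number of cycles of $\sigma$ of length $j$. Let $a_{nj}$, $1\le j\le n$, be non-negative integers, and put $h_n(\sigma)=\sum_{j\le n}a_{nj}k_j(\sigma)$ and $T_n(x)=\nu_n(h_n(\sigma)<x)$. Write $x_{(r)}=x(x-1)\cdots(x-r+1)$. Suppose that for some integer $K\ge 1$ $$\lim_{n\to\infty}\ \sum_{1\le j<n}\frac{\mathbf 1\{a_{nj}\ge K\}}{j}\Big(1-\frac jn\Big)^{\theta-1}=0 .$$ Put $b_{nj}=\min(a_{nj},K)$ and, for $l\ge 1$, $$\Upsilon_n(l)=\sum_{u=1}^{l}\theta^u\sum_{\substack{r_1+\cdots+r_u=l\\ 1\le r_i\le K}}\binom{l-1}{r_1-1}\binom{l-r_1-1}{r_2-1}\cdots\binom{l-r_1-\cdots-r_{u-1}-1}{r_u-1}\sum_{\substack{j_1,\dots,j_u\ge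 1\\ j_1+\cdots+j_u<n}}\frac{(b_{nj_1})_{(r_1)}\cdots (b_{nj_u})_{(r_u)}}{j_1\cdots j_u}\Big(1-\frac{j_1+\cdots+j_u}{n}\Big)^{\theta-1}.$$ Then $T_n$ converges weakly, as $n\to\infty$, to the distribution function $F_Y(x)=P(Y<x)$ of some random variable $Y$ with values in $\{0,1,2,\dots\}$ if and only if there is a real sequence $\Upsilon(l)$, $l\ge1$, such that $\lim_{n\to\infty}\Upsilon_n(l)=\Upsilon(l)$ for every $l\ge 1$. In that case all factorial moments of $Y$ are finite and $\mathbb E\,Y_{(l)}=\Upsilon(l)$ for every $l\ge 1$. -/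

import Mathlib

open Filter Topology MeasureTheory

noncomputable section

namespace EwensAdditive

/-- `k_j(σ)`: the number of cycles of length `j` of `σ` (fixed points are cycles of length `1`). -/
def cycleCount {n : ℕ} (σ : Equiv.Perm (Fin n)) (j : ℕ) : ℕ :=
  σ.partition.parts.count j

/-- `w(σ)`: the total number of cycles of `σ`, fixed points included. -/
def numCycles {n : ℕ} (σ : Equiv.Perm (Fin n)) : ℕ :=
  Multiset.card σ.partition.parts

/-- The rising factorial `θ (θ + 1) ⋯ (θ + n - 1)`. -/
def risingFactorial (θ : ℝ) (n : ℕ) : ℝ :=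
  ∏ i ∈ Finset.range n, (θ + (i : ℝ))

/-- The Ewens probability `ν_{n,θ}(A)` of a set `A` of permutations. -/
def ewensProb (θ : ℝ) (n : ℕ) (A : Set (Equiv.Perm (Fin n))) : ℝ :=
  (∑ σ : Equiv.Perm (Fin n), A.indicator (fun τ => θ ^ numCycles τ) σ) / risingFactorial θ n

/-- The additive function `h_n(σ) = ∑_{j ≤ n} a_{nj} k_j(σ)` given by an array `a`. -/
def additiveFun (a : ℕ → ℕ → ℕ) (n : ℕ) (σ : Equiv.Perm (Fin n)) : ℕ :=
  ∑ j ∈ Finset.Icc 1 n, a n j * cycleCount σ j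

/-- The distribution function `T_n(x) = ν_n(h_n < x)`. -/
def distFun (θ : ℝ) (a : ℕ → ℕ → ℕ) (n : ℕ) (x : ℝ) : ℝ :=
  ewensProb θ n {σ | (additiveFun a n σ : ℝ) < x}

/-- The distribution function `F_Y(x) = P(Y < x)` of a random variable `Y` with values in
`{0, 1, 2, …}` and law `μ`. -/
def lawDistFun (μ : Measure ℕ) (x : ℝ) : ℝ :=
  μ.real {k : ℕ | (k : ℝ) < x}

/-- Weak convergence of distribution functions: convergence at every continuity point of the
limit. -/
def WeakConv (T : ℕ → ℝ → ℝ) (F : ℝ → ℝ) : Prop :=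
  ∀ x : ℝ, ContinuousAt F x → Tendsto (fun n => T n x) atTop (𝓝 (F x))

/-- The tuples `(r_1, …, r_u)` with `1 ≤ r_i ≤ m` and `r_1 + ⋯ + r_u = l`. -/
def rTuples (l m u : ℕ) : Finset (Fin u → ℕ) :=
  (Fintype.piFinset fun _ : Fin u => Finset.Icc 1 m).filter fun r => ∑ i, r i = l

/-- The tuples `(j_1, …, j_u)` of positive integers with `j_1 + ⋯ + j_u < n`. -/
def jTuples (n u : ℕ) : Finset (Fin u → ℕ) :=
  (Fintype.piFinset fun _ : Fin u => Finset.Icc 1 n).filter fun j => ∑ i, j i < n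

/-- `Υ_n(l, m)`, formed from the truncated array `a_{nj}(m) = min (a_{nj}, m)`. The subtractions
of natural numbers are never truncated on the tuples that occur. -/
def Upsilon (θ : ℝ) (a : ℕ → ℕ → ℕ) (n l m : ℕ) : ℝ :=
  ∑ u ∈ Finset.Icc 1 l, θ ^ u *
    ∑ r ∈ rTuples l m u,
      (∏ i : Fin u,
        ((l - (∑ k ∈ Finset.univ.filter (fun k => k < i), r k) - 1).choose (r i - 1) : ℝ)) *
      ∑ j ∈ jTuples n u,
        (∏ i : Fin u, ((min (a n (j i)) m).descFactorial (r i) : ℝ)) / (∏ i : Fin u, (j i : ℝ)) *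
          (1 - (∑ i : Fin u, (j i : ℝ)) / (n : ℝ)) ^ (θ - 1)

end EwensAdditive

end

/-! The method is that of factorial moments. By the cycle index of the symmetric group, the
generating function in `x` of the weighted means of `(1 + t) ^ h_n` is `exp (∑ θ (1 + t) ^ b_j x ^ j
/ j)`, up to normalisation. Writing `θ (1 + t) ^ b = θ ((1 + t) ^ b - 1) + θ` splits off the factor
`(1 - x) ^ (-θ)`. With `d_n` the coefficients of the latter (`ewensCoeff`), the mean of `h_n.choose
l` is therefore `∑ m ≤ n, f_l(m) d_{n-m} / d_n` (`ewensMean_choose`), where `f_l(m)` is `factCoeff`.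
The sum `Υ_n(l)` is `l !` times the same expression for the truncated array, with `(1 - m / n) ^ (θ
- 1)` in place of `d_{n-m} / d_n` and without the term `m = n` (`Upsilon_eq_sum_factCoeff`).

The hypothesis makes the mean number of cycles with `a ≥ K` tend to `0`, so truncation at `K`
changes no point probability in the limit (`tendsto_pointProb_sub_truncArray`). For the truncated
array everything depends on a bound for `S_n = ∑ 1 / j` over the `j ≤ n` with `a_{nj} ≠ 0`. Given
such a bound, all exponential moments are uniformly bounded (`exists_ewensMean_pow_le`). Then the
two kinds of weight agree in the limit (`tendsto_ewensMean_choose_sub`), and dominated convergence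
passes between point probabilities and factorial moments in both directions
(`tendsto_ewensMean_choose`, `tendsto_pointProb`), without loss of mass.

Either side of the equivalence bounds `S_n`. Weak convergence does so because the mean of `2 ^
(-h_n)` is at most a constant times `exp (-θ S_n / 2)` and cannot tend to `0` along any subsequence
(`exists_suppSum_le_of_weakConv`). Convergence of `Υ_n(1)` does so because it is a weighted form of
`S_n` (`suppSum_le`). -/

noncomputable section

namespace EwensAdditive

/-! ### Exponentials of formal power series over an `ℝ`-algebra, later `ℝ` or `ℝ[t]`. -/

section ExpCoeff

variable {R : Type*} [CommRing R]

/-- The power series `∑ j ≥ 1, c j * x ^ j`. -/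
def weightSeries (c : ℕ → R) : PowerSeries R := PowerSeries.mk fun j => if j = 0 then 0 else c j

lemma weightSeries_add (c c' : ℕ → R) :
    weightSeries (fun j => c j + c' j) = weightSeries c + weightSeries c' := by
  ext n
  simp only [weightSeries, PowerSeries.coeff_mk, map_add]
  split_ifs <;> simp

lemma coeff_weightSeries_mul (c : ℕ → R) (P : ℕ → R) (n : ℕ) :
    PowerSeries.coeff n (weightSeries c * PowerSeries.mk P) =
      ∑ j ∈ Finset.Icc 1 n, c j * P (n - j) := by
  rw [PowerSeries.coeff_mul, Finset.Nat.sum_antidiagonal_eq_sum_range_succ_mk,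
    Finset.sum_range_succ']
  simp only [weightSeries, PowerSeries.coeff_mk, if_true, zero_mul, add_zero]
  refine Finset.sum_nbij' (· + 1) (· - 1) ?_ ?_ ?_ ?_ ?_ <;> intro k hk <;>
    simp only [Finset.mem_range, Finset.mem_Icc, add_tsub_cancel_right] at hk ⊢ <;> try omega
  rw [if_neg (by omega)]

variable [Algebra ℝ R]

/-- The coefficient of `x ^ n` in `exp (∑ j ≥ 1, c j * x ^ j / j)`. -/
def expCoeff (c : ℕ → R) : ℕ → R
  | 0 => 1
  | n + 1 => ((n : ℝ) + 1)⁻¹ • ∑ i : Fin (n + 1), c (n + 1 - i) * expCoeff c i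

/-- The power series `exp (∑ j ≥ 1, c j * x ^ j / j)`. -/
def expSeries (c : ℕ → R) : PowerSeries R := PowerSeries.mk (expCoeff c)

@[simp] lemma expCoeff_zero (c : ℕ → R) : expCoeff c 0 = 1 := by
  rw [expCoeff]

lemma smul_expCoeff (c : ℕ → R) (n : ℕ) :
    (n : ℝ) • expCoeff c n = ∑ k ∈ Finset.range n, c (n - k) * expCoeff c k := by
  cases n with
  | zero => simp
  | succ n =>
    rw [expCoeff, smul_smul, Nat.cast_succ, mul_inv_cancel₀ (by positivity), one_smul,
      Finset.sum_range]

lemma smul_expCoeff_eq_sum_Icc (c : ℕ → R) (n : ℕ) :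
    (n : ℝ) • expCoeff c n = ∑ j ∈ Finset.Icc 1 n, c j * expCoeff c (n - j) := by
  rw [smul_expCoeff]
  refine Finset.sum_bij' (fun k _ => n - k) (fun j _ => n - j) ?_ ?_ ?_ ?_ ?_ <;>
    intro k hk <;> simp only [Finset.mem_range, Finset.mem_Icc] at hk ⊢ <;> try omega
  rw [Nat.sub_sub_self hk.le]

lemma coeff_X_mul_derivative (P : PowerSeries R) (n : ℕ) :
    PowerSeries.coeff n (PowerSeries.X * PowerSeries.derivative R P) =
      (n : ℝ) • PowerSeries.coeff n P := by
  cases n with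
  | zero => simp
  | succ n =>
    rw [PowerSeries.coeff_succ_X_mul, PowerSeries.coeff_derivative, mul_comm, Algebra.smul_def]
    simp

lemma X_mul_derivative_expSeries (c : ℕ → R) :
    PowerSeries.X * PowerSeries.derivative R (expSeries c) = weightSeries c * expSeries c := by
  ext n
  rw [coeff_X_mul_derivative, expSeries, coeff_weightSeries_mul, PowerSeries.coeff_mk,
    smul_expCoeff_eq_sum_Icc]

/-- Comparing coefficients, the equation expresses `n P_n` through `P_0, …, P_{n-1}`, and `n` is
invertible. This uniqueness replaces manipulation of the exponential itself. -/
lemma eq_zero_of_X_mul_derivative {c : ℕ → R} {P : PowerSeries R}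
    (hP : PowerSeries.X * PowerSeries.derivative R P = weightSeries c * P)
    (h0 : PowerSeries.coeff 0 P = 0) : P = 0 := by
  ext n
  induction n using Nat.strong_induction_on with
  | _ n ih =>
    rcases Nat.eq_zero_or_pos n with rfl | hn
    · simpa using h0
    · have h := congrArg (PowerSeries.coeff n) hP
      have hmk : P = PowerSeries.mk fun k => PowerSeries.coeff k P := by ext; simp
      rw [coeff_X_mul_derivative, hmk, coeff_weightSeries_mul, ← hmk] at h
      rw [Finset.sum_eq_zero] at h
      · have := congrArg (fun y => ((n : ℝ)⁻¹) • y) h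
        simpa [smul_smul, hn.ne'] using this
      · intro j hj
        rw [Finset.mem_Icc] at hj
        rw [ih (n - j) (by omega)]
        simp

lemma eq_of_X_mul_derivative {c : ℕ → R} {P Q : PowerSeries R}
    (hP : PowerSeries.X * PowerSeries.derivative R P = weightSeries c * P)
    (hQ : PowerSeries.X * PowerSeries.derivative R Q = weightSeries c * Q)
    (h0 : PowerSeries.coeff 0 P = PowerSeries.coeff 0 Q) : P = Q := by
  refine sub_eq_zero.1 (eq_zero_of_X_mul_derivative (c := c) ?_ ?_)
  · rw [map_sub, mul_sub, hP, hQ, mul_sub]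
  · rw [map_sub, h0, sub_self]

lemma expSeries_add (c c' : ℕ → R) :
    expSeries (fun j => c j + c' j) = expSeries c * expSeries c' := by
  refine eq_of_X_mul_derivative (X_mul_derivative_expSeries _) ?_ (by simp [expSeries])
  rw [Derivation.leibniz, smul_eq_mul, smul_eq_mul, mul_add, weightSeries_add]
  linear_combination expSeries c * X_mul_derivative_expSeries c' +
    expSeries c' * X_mul_derivative_expSeries c

lemma expCoeff_add (c c' : ℕ → R) (n : ℕ) :
    expCoeff (fun j => c j + c' j) n =
      ∑ m ∈ Finset.range (n + 1), expCoeff c m * expCoeff c' (n - m) := by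
  have h := congrArg (PowerSeries.coeff n) (expSeries_add c c')
  rw [PowerSeries.coeff_mul, Finset.Nat.sum_antidiagonal_eq_sum_range_succ_mk] at h
  simpa [expSeries] using h

lemma map_expCoeff {S : Type*} [CommRing S] [Algebra ℝ S] (f : R →ₐ[ℝ] S) (c : ℕ → R) (n : ℕ) :
    f (expCoeff c n) = expCoeff (fun j => f (c j)) n := by
  induction n using Nat.strong_induction_on with
  | _ n ih =>
    cases n with
    | zero => simp
    | succ n =>
      rw [expCoeff, expCoeff, map_smul, map_sum]
      congr 1
      refine Finset.sum_congr rfl fun i _ => ?_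
      rw [map_mul, ih i i.2]

/-- Differentiating the coefficients of `exp (∑ j, c j * x ^ j / j)`. -/
lemma derivation_expCoeff (D : Derivation ℝ R R) (c : ℕ → R) (n : ℕ) :
    D (expCoeff c n) = ∑ j ∈ Finset.Icc 1 n, ((j : ℝ)⁻¹ • D (c j)) * expCoeff c (n - j) := by
  set E : ℕ → R := fun j => (j : ℝ)⁻¹ • D (c j)
  have hE : PowerSeries.X * PowerSeries.derivative R (weightSeries E) =
      weightSeries fun j => D (c j) := by
    ext k
    rw [coeff_X_mul_derivative]
    simp only [weightSeries, PowerSeries.coeff_mk]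
    split_ifs with hk
    · simp
    · simp [E, smul_smul, hk]
  have hD : PowerSeries.X * PowerSeries.derivative R (PowerSeries.mk fun k => D (expCoeff c k)) =
      weightSeries (fun j => D (c j)) * expSeries c +
        weightSeries c * PowerSeries.mk fun k => D (expCoeff c k) := by
    ext k
    rw [coeff_X_mul_derivative, map_add, expSeries, coeff_weightSeries_mul,
      coeff_weightSeries_mul, PowerSeries.coeff_mk, ← Finset.sum_add_distrib, ← D.map_smul,
      smul_expCoeff_eq_sum_Icc, map_sum]
    refine Finset.sum_congr rfl fun j _ => ?_
    rw [Derivation.leibniz, smul_eq_mul, smul_eq_mul]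
    ring
  -- This is `D (exp A) = D A * exp A`: the difference of the two sides solves the homogeneous
  -- equation with zero constant term.
  have key : PowerSeries.mk (fun k => D (expCoeff c k)) - weightSeries E * expSeries c = 0 := by
    refine eq_zero_of_X_mul_derivative (c := c) ?_ ?_
    · rw [map_sub, Derivation.leibniz, smul_eq_mul, smul_eq_mul]
      linear_combination hD - expSeries c * hE - weightSeries E * X_mul_derivative_expSeries c
    · rw [map_sub, expSeries, coeff_weightSeries_mul]
      simp
  have h := congrArg (PowerSeries.coeff n) (sub_eq_zero.1 key)
  rwa [expSeries, coeff_weightSeries_mul, PowerSeries.coeff_mk] at h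

end ExpCoeff

/-! ### Upper bounds for coefficients of exponentials. -/

section Bounds

lemma sum_range_sum_Icc {M : Type*} [AddCommMonoid M] (f : ℕ → ℕ → M) (n : ℕ) :
    ∑ m ∈ Finset.range (n + 1), ∑ j ∈ Finset.Icc 1 m, f j (m - j) =
      ∑ j ∈ Finset.Icc 1 n, ∑ k ∈ Finset.range (n + 1 - j), f j k := by
  rw [Finset.sum_comm' (t' := Finset.Icc 1 n) (s' := fun j => Finset.Icc j n)
    (by intro m j; simp only [Finset.mem_range, Finset.mem_Icc]; omega)]
  refine Finset.sum_congr rfl fun j hj => ?_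
  rw [Finset.mem_Icc] at hj
  refine Finset.sum_nbij' (· - j) (· + j) ?_ ?_ ?_ ?_ ?_ <;> intro k hk <;>
    simp only [Finset.mem_range, Finset.mem_Icc] at hk ⊢ <;> omega

lemma mul_expCoeff (c : ℕ → ℝ) (n : ℕ) :
    n * expCoeff c n = ∑ k ∈ Finset.range n, c (n - k) * expCoeff c k :=
  smul_expCoeff c n

lemma expCoeff_nonneg {c : ℕ → ℝ} (hc : ∀ j, 0 ≤ c j) (n : ℕ) : 0 ≤ expCoeff c n := by
  induction n using Nat.strong_induction_on with
  | _ n ih =>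
    cases n with
    | zero => simp
    | succ n =>
      rw [expCoeff]
      exact smul_nonneg (by positivity) (Finset.sum_nonneg fun i _ => mul_nonneg (hc _) (ih i i.2))

/-- The partial sums of the coefficients of an exponential are at most its value at `1`. -/
lemma sum_expCoeff_le_exp {c : ℕ → ℝ} (hc : ∀ j, 0 ≤ c j) (n : ℕ) :
    ∑ m ∈ Finset.range (n + 1), expCoeff c m ≤ Real.exp (∑ j ∈ Finset.Icc 1 n, c j / j) := by
  set p := expCoeff c with hp
  have hp0 : ∀ m, 0 ≤ p m := expCoeff_nonneg hc
  let F : ℝ → ℝ := fun x => ∑ m ∈ Finset.range (n + 1), p m * x ^ m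
  let A : ℝ → ℝ := fun x => ∑ j ∈ Finset.Icc 1 n, c j / j * x ^ j
  have hF : ∀ x, HasDerivAt F (∑ m ∈ Finset.range (n + 1), p m * (m * x ^ (m - 1))) x := fun x =>
    HasDerivAt.fun_sum fun m _ => (hasDerivAt_pow m x).const_mul _
  have hA : ∀ x, HasDerivAt A (∑ j ∈ Finset.Icc 1 n, c j / j * (j * x ^ (j - 1))) x := fun x =>
    HasDerivAt.fun_sum fun m _ => (hasDerivAt_pow m x).const_mul _
  have hG : ∀ x, HasDerivAt (fun x => F x * Real.exp (-A x)) _ x := fun x =>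
    (hF x).mul (hA x).neg.exp
  -- The recursion writes `x F'` as a sum over pairs `(j, k)` with `j + k ≤ n`, whereas `x A' F`
  -- runs over all `j, k ≤ n`; hence `F' ≤ A' F` on `(0, 1)`. Comparing the values at `0` and `1`
  -- gives the claim.
  have hanti : AntitoneOn (fun x => F x * Real.exp (-A x)) (Set.Icc 0 1) := by
    refine antitoneOn_of_deriv_nonpos (convex_Icc 0 1)
      (fun x _ => (hG x).continuousAt.continuousWithinAt)
      (fun x _ => (hG x).differentiableAt.differentiableWithinAt) fun x hx => ?_
    rw [interior_Icc] at hx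
    have hx0 : 0 < x := hx.1
    rw [(hG x).deriv]
    have key : x * (∑ m ∈ Finset.range (n + 1), p m * (m * x ^ (m - 1))) ≤
        x * ((∑ j ∈ Finset.Icc 1 n, c j / j * (j * x ^ (j - 1))) * F x) := by
      have h1 : x * (∑ m ∈ Finset.range (n + 1), p m * (m * x ^ (m - 1))) =
          ∑ m ∈ Finset.range (n + 1), ∑ j ∈ Finset.Icc 1 m,
            (c j * x ^ j) * (p (m - j) * x ^ (m - j)) := by
        rw [Finset.mul_sum]
        refine Finset.sum_congr rfl fun m _ => ?_
        have : x * (p m * (m * x ^ (m - 1))) = (m * p m) * x ^ m := by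
          cases m with
          | zero => simp
          | succ m => rw [pow_succ, Nat.add_sub_cancel]; ring
        have h2 : (m : ℝ) * p m = ∑ j ∈ Finset.Icc 1 m, c j * p (m - j) :=
          smul_expCoeff_eq_sum_Icc c m
        rw [this, h2, Finset.sum_mul]
        refine Finset.sum_congr rfl fun j hj => ?_
        rw [Finset.mem_Icc] at hj
        rw [show x ^ m = x ^ j * x ^ (m - j) by rw [← pow_add, Nat.add_sub_cancel' hj.2]]
        ring
      have h2 : x * ((∑ j ∈ Finset.Icc 1 n, c j / j * (j * x ^ (j - 1))) * F x) =
          ∑ j ∈ Finset.Icc 1 n, ∑ k ∈ Finset.range (n + 1), (c j * x ^ j) * (p k * x ^ k) := by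
        rw [← mul_assoc, Finset.mul_sum (a := x), Finset.sum_mul_sum]
        refine Finset.sum_congr rfl fun j hj => Finset.sum_congr rfl fun k _ => ?_
        rw [Finset.mem_Icc] at hj
        obtain ⟨i, rfl⟩ := Nat.exists_eq_add_of_le' hj.1
        have : ((i + 1 : ℕ) : ℝ) ≠ 0 := by positivity
        rw [Nat.add_sub_cancel, pow_succ]
        field_simp
      rw [h1, h2, sum_range_sum_Icc fun j k => (c j * x ^ j) * (p k * x ^ k)]
      refine Finset.sum_le_sum fun j _ => Finset.sum_le_sum_of_subset_of_nonneg
        (Finset.range_mono (Nat.sub_le _ _)) fun k _ _ => ?_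
      exact mul_nonneg (mul_nonneg (hc _) (pow_nonneg hx0.le _))
        (mul_nonneg (hp0 _) (pow_nonneg hx0.le _))
    have key' := le_of_mul_le_mul_left key hx0
    have he := mul_le_mul_of_nonneg_right key' (Real.exp_pos (-A x)).le
    rw [Pi.neg_apply]
    linarith
  have h := hanti (by simp) (by simp) (zero_le_one' ℝ)
  have hF0 : F 0 = 1 := by
    simp only [F]
    rw [Finset.sum_eq_single 0] <;> simp +contextual [hp]
  have hA0 : A 0 = 0 := Finset.sum_eq_zero fun j hj => by
    rw [Finset.mem_Icc] at hj
    simp [zero_pow (by omega : j ≠ 0)]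
  simp only [hF0, hA0, neg_zero, Real.exp_zero, mul_one, Real.exp_neg] at h
  rw [← div_eq_mul_inv, div_le_one (Real.exp_pos _)] at h
  simpa [F, A] using h

/-- The recursion bounds `n` times the coefficient by `M` times a partial sum of earlier ones, which
gains a factor `1 / n` over the bound for the partial sums. -/
lemma expCoeff_le {c : ℕ → ℝ} (hc : ∀ j, 0 ≤ c j) {M : ℝ} (hM : ∀ j, c j ≤ M) {n : ℕ}
    (hn : 1 ≤ n) : expCoeff c n ≤ M / n * Real.exp (∑ j ∈ Finset.Icc 1 n, c j / j) := by
  have hn' : (0 : ℝ) < n := by exact_mod_cast hn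
  rw [div_mul_eq_mul_div, le_div_iff₀ hn', mul_comm, mul_expCoeff]
  calc ∑ k ∈ Finset.range n, c (n - k) * expCoeff c k
      ≤ ∑ k ∈ Finset.range n, M * expCoeff c k :=
        Finset.sum_le_sum fun k _ => mul_le_mul_of_nonneg_right (hM _) (expCoeff_nonneg hc k)
    _ = M * ∑ k ∈ Finset.range n, expCoeff c k := by rw [Finset.mul_sum]
    _ ≤ M * Real.exp (∑ j ∈ Finset.Icc 1 n, c j / j) := by
        refine mul_le_mul_of_nonneg_left (le_trans ?_ (sum_expCoeff_le_exp hc n))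
          ((hc 0).trans (hM 0))
        rw [Finset.sum_range_succ]
        exact le_add_of_nonneg_right (expCoeff_nonneg hc n)

end Bounds

/-! ### The cycle index of the symmetric group. -/

section CycleIndex

variable {R : Type*} [CommRing R] [Algebra ℝ R]

/-- The number of permutations of a set of `s.sum` elements whose cycle lengths form `s` is
`s.sum !` divided by this number. -/
def centralizerCard (s : Multiset ℕ) : ℕ := s.prod * ∏ i ∈ s.toFinset, (s.count i).factorial

lemma centralizerCard_cons (j : ℕ) (s : Multiset ℕ) :
    centralizerCard (j ::ₘ s) = j * (s.count j + 1) * centralizerCard s := by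
  have h1 : ∀ t : Multiset ℕ, t ≤ j ::ₘ s → ∏ i ∈ t.toFinset, (t.count i).factorial =
      ∏ i ∈ insert j s.toFinset, (t.count i).factorial := fun t ht =>
    Finset.prod_subset (fun i hi => by
        simpa using Multiset.mem_of_le ht (Multiset.mem_toFinset.1 hi)) fun i _ hi => by
      rw [Multiset.mem_toFinset] at hi
      rw [Multiset.count_eq_zero_of_notMem hi, Nat.factorial_zero]
  rw [centralizerCard, centralizerCard, h1 _ le_rfl, h1 s (Multiset.le_cons_self s j),
    Multiset.prod_cons, ← Finset.mul_prod_erase _ _ (Finset.mem_insert_self j _),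
    ← Finset.mul_prod_erase _ (fun i => (s.count i).factorial) (Finset.mem_insert_self j _),
    Multiset.count_cons_self, Nat.factorial_succ]
  have h2 : ∏ i ∈ (insert j s.toFinset).erase j, ((j ::ₘ s).count i).factorial =
      ∏ i ∈ (insert j s.toFinset).erase j, (s.count i).factorial :=
    Finset.prod_congr rfl fun i hi => by rw [Multiset.count_cons_of_ne (Finset.ne_of_mem_erase hi)]
  rw [h2]
  ring

/-- The contribution of the cycle lengths `s` to the cycle index. -/
def cycleWeight (c : ℕ → R) (s : Multiset ℕ) : R := (centralizerCard s : ℝ)⁻¹ • (s.map c).prod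

lemma smul_cycleWeight_cons (c : ℕ → R) {j : ℕ} (hj : j ≠ 0) (s : Multiset ℕ) :
    ((j * (j ::ₘ s).count j : ℕ) : ℝ) • cycleWeight c (j ::ₘ s) = c j * cycleWeight c s := by
  have h : ((j * (s.count j + 1) : ℕ) : ℝ) ≠ 0 := by positivity
  rw [cycleWeight, cycleWeight, centralizerCard_cons, smul_smul, Multiset.count_cons_self,
    Nat.cast_mul _ (centralizerCard s), mul_inv, ← mul_assoc, mul_inv_cancel₀ h, one_mul,
    Multiset.map_cons, Multiset.prod_cons, mul_smul_comm]

/-- Deleting one part `j` is a bijection from the partitions of `n` containing `j` to the partitions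
of `n - j`. -/
lemma sum_smul_cycleWeight (c : ℕ → R) {n j : ℕ} (hj : 1 ≤ j) (hjn : j ≤ n) :
    ∑ s : Nat.Partition n, ((j * s.parts.count j : ℕ) : ℝ) • cycleWeight c s.parts =
      c j * ∑ s : Nat.Partition (n - j), cycleWeight c s.parts := by
  rw [Finset.mul_sum, ← Finset.sum_filter_of_ne (p := fun s : Nat.Partition n => j ∈ s.parts)]
  · symm
    refine Finset.sum_bij (fun s _ => ⟨j ::ₘ s.parts, ?_, ?_⟩) ?_ ?_ ?_ ?_
    · intro i hi
      rcases Multiset.mem_cons.1 hi with rfl | hi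
      · omega
      · exact s.parts_pos hi
    · rw [Multiset.sum_cons, s.parts_sum]
      omega
    · intro s _
      simp
    · intro s _ t _ h
      rw [Nat.Partition.ext_iff] at h ⊢
      simpa using h
    · intro s hs
      rw [Finset.mem_filter] at hs
      refine ⟨⟨s.parts.erase j, fun hi => s.parts_pos (Multiset.mem_of_mem_erase hi), ?_⟩,
        Finset.mem_univ _, ?_⟩
      · have := s.parts_sum
        rw [← Multiset.cons_erase hs.2, Multiset.sum_cons] at this
        omega
      · rw [Nat.Partition.ext_iff]
        exact Multiset.cons_erase hs.2
    · intro s _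
      rw [smul_cycleWeight_cons c (by omega)]
  · intro s _ h
    by_contra hjs
    exact h (by rw [Multiset.count_eq_zero_of_notMem hjs]; simp)

lemma sum_cycleWeight (c : ℕ → R) (n : ℕ) :
    ∑ s : Nat.Partition n, cycleWeight c s.parts = expCoeff c n := by
  induction n using Nat.strong_induction_on with
  | _ n ih =>
    rcases Nat.eq_zero_or_pos n with rfl | hn
    · rw [Fintype.sum_unique, expCoeff_zero]
      simp [cycleWeight, centralizerCard]
    · have h : (n : ℝ) • ∑ s : Nat.Partition n, cycleWeight c s.parts = (n : ℝ) • expCoeff c n := by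
        rw [smul_expCoeff_eq_sum_Icc, Finset.smul_sum]
        -- Since `n` is the sum of `j` times the multiplicity of `j`, the partition sum obeys the
        -- recursion of `expCoeff`.
        have h1 : ∀ s : Nat.Partition n, (n : ℝ) • cycleWeight c s.parts =
            ∑ j ∈ Finset.Icc 1 n, ((j * s.parts.count j : ℕ) : ℝ) • cycleWeight c s.parts := by
          intro s
          rw [← Finset.sum_smul, ← Nat.cast_sum]
          congr 2
          conv_lhs => rw [← s.parts_sum, Finset.sum_multiset_count]
          simp only [smul_eq_mul, mul_comm]
          refine Finset.sum_subset ?_ ?_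
          · intro j hj
            rw [Multiset.mem_toFinset] at hj
            rw [Finset.mem_Icc]
            refine ⟨s.parts_pos hj, ?_⟩
            exact (Multiset.single_le_sum (fun _ _ => Nat.zero_le _) j hj).trans s.parts_sum.le
          · intro j _ hj
            rw [Multiset.mem_toFinset] at hj
            rw [Multiset.count_eq_zero_of_notMem hj, mul_zero]
        rw [Finset.sum_congr rfl fun s _ => h1 s, Finset.sum_comm]
        refine Finset.sum_congr rfl fun j hj => ?_
        rw [Finset.mem_Icc] at hj
        rw [sum_smul_cycleWeight c hj.1 hj.2, ih (n - j) (by omega)]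
      have := congrArg (fun y => (n : ℝ)⁻¹ • y) h
      simpa [smul_smul, hn.ne'] using this

/-- `Equiv.Perm.card_of_cycleType_mul_eq` counts by cycle type, which omits fixed points; the parts
equal to `1` supply the remaining factorial. -/
lemma card_partition_mul {α : Type*} [Fintype α] [DecidableEq α]
    (s : Nat.Partition (Fintype.card α)) :
    (Finset.univ.filter fun σ : Equiv.Perm α => σ.partition = s).card * centralizerCard s.parts =
      (Fintype.card α).factorial := by
  set m := s.parts.filter (2 ≤ ·) with hm
  have hone : s.parts.filter (fun i => ¬ 2 ≤ i) = Multiset.replicate (s.parts.count 1) 1 := by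
    rw [← Multiset.filter_eq']
    refine Multiset.filter_congr fun i hi => ?_
    have := s.parts_pos hi
    omega
  have hs : m + Multiset.replicate (s.parts.count 1) 1 = s.parts := by
    rw [← hone, Multiset.filter_add_not]
  have hsum : m.sum + s.parts.count 1 = Fintype.card α := by
    have := s.parts_sum
    rw [← hs, Multiset.sum_add, Multiset.sum_replicate] at this
    simpa [hs] using this
  have hm2 : ∀ a ∈ m, 2 ≤ a := fun a ha => (Multiset.mem_filter.1 ha).2
  have hcard := Equiv.Perm.card_of_cycleType_mul_eq α m
  rw [if_pos ⟨by omega, hm2⟩, show Fintype.card α - m.sum = s.parts.count 1 by omega] at hcard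
  rw [← hcard]
  congr 1
  · congr 1
    ext σ
    simp only [Finset.mem_filter, Finset.mem_univ, true_and]
    constructor
    · rintro rfl
      rw [hm, Equiv.Perm.filter_parts_partition_eq_cycleType]
    · intro h
      rw [Nat.Partition.ext_iff, Equiv.Perm.parts_partition, h, ← Equiv.Perm.sum_cycleType, h,
        ← hs]
      congr 2
      omega
  · have hprod : s.parts.prod = m.prod := by
      rw [← hs, Multiset.prod_add]
      simp
    rw [centralizerCard, hprod]
    have h1 : ∏ i ∈ s.parts.toFinset, (s.parts.count i).factorial =
        ∏ i ∈ insert 1 m.toFinset, (s.parts.count i).factorial := by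
      refine Finset.prod_subset (fun i hi => ?_) fun i _ hi => ?_
      · rw [Multiset.mem_toFinset] at hi
        rw [Finset.mem_insert, Multiset.mem_toFinset, hm, Multiset.mem_filter]
        have := s.parts_pos hi
        rcases Nat.lt_or_ge i 2 with h | h
        · left; omega
        · exact Or.inr ⟨hi, h⟩
      · rw [Multiset.mem_toFinset] at hi
        rw [Multiset.count_eq_zero_of_notMem hi, Nat.factorial_zero]
    rw [h1, Finset.prod_insert (by
      rw [Multiset.mem_toFinset]; intro h; have := hm2 1 h; omega)]
    have h2 : ∏ i ∈ m.toFinset, (s.parts.count i).factorial =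
        ∏ i ∈ m.toFinset, (m.count i).factorial :=
      Finset.prod_congr rfl fun i hi => by
        rw [hm, Multiset.count_filter_of_pos (hm2 i (Multiset.mem_toFinset.1 hi))]
    rw [h2]
    ring

/-- The cycle index of the symmetric group. -/
lemma sum_prod_map_parts {α : Type*} [Fintype α] [DecidableEq α] (c : ℕ → R) :
    ∑ σ : Equiv.Perm α, (σ.partition.parts.map c).prod =
      ((Fintype.card α).factorial : ℝ) • expCoeff c (Fintype.card α) := by
  rw [← sum_cycleWeight, Finset.smul_sum,
    ← Finset.sum_fiberwise_of_maps_to (s := Finset.univ) (t := Finset.univ)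
      (g := fun σ : Equiv.Perm α => σ.partition) (fun _ _ => Finset.mem_univ _)]
  refine Finset.sum_congr rfl fun s _ => ?_
  rw [Finset.sum_congr rfl (g := fun _ => (s.parts.map c).prod) fun σ hσ => by
    rw [(Finset.mem_filter.1 hσ).2], Finset.sum_const, ← card_partition_mul s, cycleWeight,
    smul_smul, Nat.cast_mul, mul_assoc, mul_inv_cancel₀, mul_one, Nat.cast_smul_eq_nsmul]
  intro h
  have := card_partition_mul s
  rw [Nat.cast_eq_zero.1 h, mul_zero] at this
  exact (Nat.factorial_pos _).ne this

lemma prod_pow_cycleCount {R : Type*} [CommRing R] {n : ℕ} (c : ℕ → R) (σ : Equiv.Perm (Fin n)) :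
    ∏ j ∈ Finset.Icc 1 n, c j ^ cycleCount σ j = (σ.partition.parts.map c).prod := by
  rw [Finset.prod_multiset_map_count]
  symm
  refine Finset.prod_subset (fun j hj => ?_) fun j _ hj => ?_
  · rw [Multiset.mem_toFinset] at hj
    rw [Finset.mem_Icc]
    refine ⟨σ.partition.parts_pos hj, ?_⟩
    exact (Multiset.single_le_sum (fun _ _ => Nat.zero_le _) j hj).trans
      (σ.partition.parts_sum.trans (Fintype.card_fin n)).le
  · rw [Multiset.mem_toFinset] at hj
    rw [Multiset.count_eq_zero_of_notMem hj, pow_zero]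

lemma sum_prod_pow_cycleCount (n : ℕ) (c : ℕ → R) :
    ∑ σ : Equiv.Perm (Fin n), ∏ j ∈ Finset.Icc 1 n, c j ^ cycleCount σ j =
      (n.factorial : ℝ) • expCoeff c n := by
  have h := sum_prod_map_parts (α := Fin n) c
  simp only [← prod_pow_cycleCount] at h
  simpa only [Fintype.card_fin] using h

end CycleIndex

/-! ### Asymptotics of the coefficients of `(1 - x) ^ (-θ)`. -/

section Asymptotics

/-- The coefficient `θ (θ + 1) ⋯ (θ + n - 1) / n!` of `x ^ n` in `(1 - x) ^ (-θ)`. -/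
def ewensCoeff (θ : ℝ) (n : ℕ) : ℝ := risingFactorial θ n / n.factorial

lemma risingFactorial_pos {θ : ℝ} (hθ : 0 < θ) (n : ℕ) : 0 < risingFactorial θ n :=
  Finset.prod_pos fun i _ => by positivity

lemma ewensCoeff_pos {θ : ℝ} (hθ : 0 < θ) (n : ℕ) : 0 < ewensCoeff θ n :=
  div_pos (risingFactorial_pos hθ n) (by positivity)

@[simp] lemma ewensCoeff_zero (θ : ℝ) : ewensCoeff θ 0 = 1 := by
  simp [ewensCoeff, risingFactorial]

lemma ewensCoeff_succ (θ : ℝ) (n : ℕ) :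
    ewensCoeff θ (n + 1) = (θ + n) / (n + 1) * ewensCoeff θ n := by
  rw [ewensCoeff, ewensCoeff, risingFactorial, Finset.prod_range_succ, ← risingFactorial,
    Nat.factorial_succ]
  push_cast
  field_simp

lemma expCoeff_const (θ : ℝ) (n : ℕ) : expCoeff (fun _ => θ) n = ewensCoeff θ n := by
  induction n with
  | zero => simp
  | succ n ih =>
    have h1 := mul_expCoeff (fun _ => θ) (n + 1)
    have h2 := mul_expCoeff (fun _ => θ) n
    rw [Finset.sum_range_succ, ← h2, ih] at h1
    rw [ewensCoeff_succ]
    push_cast at h1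
    field_simp
    linarith

/-- Up to the factor `n / (n + θ)`, this is the reciprocal of Euler's product for `Γ(θ)`. -/
lemma tendsto_ewensCoeff_mul_rpow {θ : ℝ} (hθ : 0 < θ) :
    Tendsto (fun n : ℕ => ewensCoeff θ n * (n : ℝ) ^ (1 - θ)) atTop (𝓝 (Real.Gamma θ)⁻¹) := by
  have h1 : Tendsto (fun n : ℕ => (n : ℝ) / (n + θ)) atTop (𝓝 1) :=
    tendsto_natCast_div_add_atTop θ
  have h2 := h1.mul ((Real.GammaSeq_tendsto_Gamma θ).inv₀ (Real.Gamma_pos_of_pos hθ).ne')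
  rw [one_mul] at h2
  refine h2.congr' ?_
  filter_upwards [eventually_ge_atTop 1] with n hn
  have hn' : (0 : ℝ) < n := by exact_mod_cast hn
  rw [Real.GammaSeq, Finset.prod_range_succ, ewensCoeff, risingFactorial, Real.rpow_sub hn',
    Real.rpow_one]
  have : (n : ℝ) + θ ≠ 0 := by positivity
  have : θ + (n : ℝ) ≠ 0 := by positivity
  have : (n : ℝ) ^ θ ≠ 0 := (Real.rpow_pos_of_pos hn' θ).ne'
  have : ((n.factorial : ℕ) : ℝ) ≠ 0 := by positivity
  rw [inv_div]
  field_simp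
  ring

lemma exists_bounds_ewensCoeff {θ : ℝ} (hθ : 0 < θ) :
    ∃ A B : ℝ, 0 < A ∧ 0 < B ∧ ∀ n : ℕ, 1 ≤ n →
      A * (n : ℝ) ^ (θ - 1) ≤ ewensCoeff θ n ∧ ewensCoeff θ n ≤ B * (n : ℝ) ^ (θ - 1) := by
  have hL : 0 < (Real.Gamma θ)⁻¹ := inv_pos.2 (Real.Gamma_pos_of_pos hθ)
  obtain ⟨B, hB⟩ := (tendsto_ewensCoeff_mul_rpow hθ).bddAbove_range
  obtain ⟨A, hA⟩ := ((tendsto_ewensCoeff_mul_rpow hθ).inv₀ hL.ne').bddAbove_range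
  have key : ∀ n : ℕ, 1 ≤ n →
      0 < (n : ℝ) ^ (1 - θ) ∧ (n : ℝ) ^ (1 - θ) * (n : ℝ) ^ (θ - 1) = 1 := by
    intro n hn
    have hn' : (0 : ℝ) < n := by exact_mod_cast hn
    refine ⟨Real.rpow_pos_of_pos hn' _, ?_⟩
    rw [← Real.rpow_add hn']
    simp
  have hA' : ∀ n : ℕ, (ewensCoeff θ n * (n : ℝ) ^ (1 - θ))⁻¹ ≤ A := fun n => hA ⟨n, rfl⟩
  have hB' : ∀ n : ℕ, ewensCoeff θ n * (n : ℝ) ^ (1 - θ) ≤ B := fun n => hB ⟨n, rfl⟩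
  have hpos : ∀ n : ℕ, 1 ≤ n → 0 < ewensCoeff θ n * (n : ℝ) ^ (1 - θ) := fun n hn =>
    mul_pos (ewensCoeff_pos hθ n) (key n hn).1
  have hA0 : 0 < A := (inv_pos.2 (hpos 1 le_rfl)).trans_le (hA' 1)
  refine ⟨A⁻¹, B, inv_pos.2 hA0, (hpos 1 le_rfl).trans_le (hB' 1), fun n hn => ?_⟩
  obtain ⟨h1, h2⟩ := key n hn
  have h3 : 0 < (n : ℝ) ^ (θ - 1) := by
    have hn' : (0 : ℝ) < n := by exact_mod_cast hn
    exact Real.rpow_pos_of_pos hn' _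
  have h4 : ewensCoeff θ n = ewensCoeff θ n * (n : ℝ) ^ (1 - θ) * (n : ℝ) ^ (θ - 1) := by
    rw [mul_assoc, h2, mul_one]
  rw [h4]
  exact ⟨mul_le_mul_of_nonneg_right (inv_le_of_inv_le₀ (hpos n hn) (hA' n)) h3.le,
    mul_le_mul_of_nonneg_right (hB' n) h3.le⟩

lemma rpow_one_sub_div {n m : ℕ} (hm : m < n) (s : ℝ) :
    (1 - (m : ℝ) / n) ^ s = ((n - m : ℕ) : ℝ) ^ s / (n : ℝ) ^ s := by
  have hn : (0 : ℝ) < n := by exact_mod_cast (Nat.zero_le m).trans_lt hm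
  rw [← Real.div_rpow (by positivity) hn.le, Nat.cast_sub hm.le, sub_div, div_self hn.ne']

lemma rpow_one_sub_div_pos {n m : ℕ} (hm : m < n) (s : ℝ) : 0 < (1 - (m : ℝ) / n) ^ s := by
  refine Real.rpow_pos_of_pos ?_ _
  have hn : (0 : ℝ) < n := by exact_mod_cast (Nat.zero_le m).trans_lt hm
  rw [sub_pos, div_lt_one hn]
  exact_mod_cast hm

lemma exists_ewensCoeff_div_bounds {θ : ℝ} (hθ : 0 < θ) :
    ∃ C : ℝ, 0 < C ∧ ∀ n m : ℕ, m < n →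
      ewensCoeff θ (n - m) / ewensCoeff θ n ≤ C * (1 - (m : ℝ) / n) ^ (θ - 1) ∧
      (1 - (m : ℝ) / n) ^ (θ - 1) ≤ C * (ewensCoeff θ (n - m) / ewensCoeff θ n) := by
  obtain ⟨A, B, hA, hB, h⟩ := exists_bounds_ewensCoeff hθ
  refine ⟨B / A, by positivity, fun n m hm => ?_⟩
  obtain ⟨h1, h2⟩ := h (n - m) (by omega)
  obtain ⟨h3, h4⟩ := h n (by omega)
  have hn : (0 : ℝ) < n := by exact_mod_cast (Nat.zero_le m).trans_lt hm
  have hk : (0 : ℝ) < (n - m : ℕ) := by exact_mod_cast Nat.sub_pos_of_lt hm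
  have hn' := Real.rpow_pos_of_pos hn (θ - 1)
  have hk' := Real.rpow_pos_of_pos hk (θ - 1)
  have hd := ewensCoeff_pos hθ n
  have hd' := ewensCoeff_pos hθ (n - m)
  rw [rpow_one_sub_div hm]
  constructor
  · calc ewensCoeff θ (n - m) / ewensCoeff θ n
        ≤ (B * ((n - m : ℕ) : ℝ) ^ (θ - 1)) / (A * (n : ℝ) ^ (θ - 1)) := by gcongr
      _ = _ := by field_simp
  · calc ((n - m : ℕ) : ℝ) ^ (θ - 1) / (n : ℝ) ^ (θ - 1)
        = B / A * ((A * ((n - m : ℕ) : ℝ) ^ (θ - 1)) / (B * (n : ℝ) ^ (θ - 1))) := by field_simp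
      _ ≤ _ := by gcongr

/-- Normalised by `n ^ (1 - θ)`, the coefficients have a nonzero limit, so their quotients tend to
`1` uniformly once both indices are large. Only the `m` within `N` of `n` escape. -/
lemma exists_abs_ewensCoeff_div_sub_le {θ : ℝ} (hθ : 0 < θ) {ε : ℝ} (hε : 0 < ε) :
    ∃ N : ℕ, 1 ≤ N ∧ ∀ n m : ℕ, m + N ≤ n →
      |ewensCoeff θ (n - m) / ewensCoeff θ n - (1 - (m : ℝ) / n) ^ (θ - 1)| ≤
        ε * (1 - (m : ℝ) / n) ^ (θ - 1) := by
  have hL : 0 < (Real.Gamma θ)⁻¹ := inv_pos.2 (Real.Gamma_pos_of_pos hθ)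
  have ht := tendsto_ewensCoeff_mul_rpow hθ
  set e : ℕ → ℝ := fun n => ewensCoeff θ n * (n : ℝ) ^ (1 - θ) with he
  have h2 : Tendsto (fun p : ℕ × ℕ => e p.1 / e p.2) (atTop ×ˢ atTop) (𝓝 1) := by
    have := (ht.comp (tendsto_fst (f := atTop) (g := (atTop : Filter ℕ)))).div
      (ht.comp (tendsto_snd (f := (atTop : Filter ℕ)) (g := atTop))) hL.ne'
    rwa [div_self hL.ne'] at this
  have h3 := h2 (Metric.closedBall_mem_nhds 1 hε)
  rw [prod_atTop_atTop_eq, mem_map, mem_atTop_sets] at h3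
  obtain ⟨⟨a, b⟩, hab⟩ := h3
  refine ⟨max 1 (max a b), le_max_left _ _, fun n m hm => ?_⟩
  have h4 := hab (n - m, n) ⟨by simp only; omega, by simp only; omega⟩
  rw [Set.mem_preimage, Metric.mem_closedBall, Real.dist_eq] at h4
  have hmn : m < n := by omega
  have hk : (0 : ℝ) < (n - m : ℕ) := by exact_mod_cast Nat.sub_pos_of_lt hmn
  have hn : (0 : ℝ) < n := by exact_mod_cast (Nat.zero_le m).trans_lt hmn
  have hR := rpow_one_sub_div_pos hmn (θ - 1)
  have h5 : ewensCoeff θ (n - m) / ewensCoeff θ n =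
      e (n - m) / e n * (1 - (m : ℝ) / n) ^ (θ - 1) := by
    have hs : ∀ x : ℝ, 0 < x → x ^ (1 - θ) = (x ^ (θ - 1))⁻¹ := fun x hx => by
      rw [← Real.rpow_neg hx.le, neg_sub]
    rw [rpow_one_sub_div hmn, he]
    simp only
    rw [hs _ hk, hs _ hn]
    have := (Real.rpow_pos_of_pos hn (θ - 1)).ne'
    have := (Real.rpow_pos_of_pos hk (θ - 1)).ne'
    have := (ewensCoeff_pos hθ n).ne'
    field_simp
  rw [h5]
  calc |e (n - m) / e n * (1 - (m : ℝ) / n) ^ (θ - 1) - (1 - (m : ℝ) / n) ^ (θ - 1)|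
      = |e (n - m) / e n - 1| * (1 - (m : ℝ) / n) ^ (θ - 1) := by
        rw [← sub_one_mul, abs_mul, abs_of_pos hR]
    _ ≤ _ := mul_le_mul_of_nonneg_right h4 hR.le

/-- The product is of order `n ^ θ`. Boundary contributions near `m = n` are later bounded by
constants over it. -/
lemma tendsto_natCast_mul_ewensCoeff {θ : ℝ} (hθ : 0 < θ) :
    Tendsto (fun n : ℕ => (n : ℝ) * ewensCoeff θ n) atTop atTop := by
  obtain ⟨A, _, hA, _, h⟩ := exists_bounds_ewensCoeff hθ
  have h1 : Tendsto (fun n : ℕ => A * (n : ℝ) ^ θ) atTop atTop :=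
    ((tendsto_rpow_atTop hθ).comp tendsto_natCast_atTop_atTop).const_mul_atTop hA
  refine tendsto_atTop_mono' _ ?_ h1
  filter_upwards [eventually_ge_atTop 1] with n hn
  have hn' : (0 : ℝ) < n := by exact_mod_cast hn
  have h2 := mul_le_mul_of_nonneg_left (h n hn).1 hn'.le
  rw [Real.rpow_sub_one hn'.ne'] at h2
  refine le_trans (le_of_eq ?_) h2
  field_simp

lemma exists_exp_harmonic_le {θ : ℝ} (hθ : 0 < θ) :
    ∃ C : ℝ, 0 < C ∧ ∀ n : ℕ, 1 ≤ n →
      Real.exp (∑ j ∈ Finset.Icc 1 n, θ / j) ≤ C * (n * ewensCoeff θ n) := by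
  obtain ⟨A, _, hA, _, h⟩ := exists_bounds_ewensCoeff hθ
  refine ⟨Real.exp θ / A, by positivity, fun n hn => ?_⟩
  have hn' : (0 : ℝ) < n := by exact_mod_cast hn
  have h1 := harmonic_le_one_add_log n
  rw [harmonic_eq_sum_Icc] at h1
  push_cast at h1
  calc Real.exp (∑ j ∈ Finset.Icc 1 n, θ / j)
      = Real.exp (θ * ∑ j ∈ Finset.Icc 1 n, (j : ℝ)⁻¹) := by
        rw [Finset.mul_sum]; simp only [div_eq_mul_inv]
    _ ≤ Real.exp (θ * (1 + Real.log n)) :=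
        Real.exp_le_exp.2 (mul_le_mul_of_nonneg_left h1 hθ.le)
    _ = Real.exp θ * (n : ℝ) ^ θ := by
        rw [mul_add, Real.exp_add, mul_one, Real.rpow_def_of_pos hn', mul_comm θ (Real.log n)]
    _ = Real.exp θ / A * (n * (A * (n : ℝ) ^ (θ - 1))) := by
        rw [Real.rpow_sub_one hn'.ne']; field_simp
    _ ≤ _ := by
        gcongr
        exact (h n hn).1

/-- Combines `expCoeff_le` with `exp (θ ∑ 1 / j) = O(n d_n)`, where `d_n` is `ewensCoeff`: the
factor `1 / n` cancels and only the deviation of `c` from `θ` remains in the exponent. -/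
lemma exists_expCoeff_div_ewensCoeff_le {θ : ℝ} (hθ : 0 < θ) :
    ∃ C : ℝ, 0 < C ∧ ∀ (c : ℕ → ℝ) (M : ℝ), (∀ j, 0 ≤ c j) → (∀ j, c j ≤ M) → ∀ n : ℕ, 1 ≤ n →
      expCoeff c n / ewensCoeff θ n ≤
        C * M * Real.exp (∑ j ∈ Finset.Icc 1 n, (c j - θ) / j) := by
  obtain ⟨C, hC, h⟩ := exists_exp_harmonic_le hθ
  refine ⟨C, hC, fun c M hc hM n hn => ?_⟩
  have hn' : (0 : ℝ) < n := by exact_mod_cast hn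
  have hM0 : 0 ≤ M := (hc 0).trans (hM 0)
  rw [div_le_iff₀ (ewensCoeff_pos hθ n)]
  calc expCoeff c n ≤ M / n * Real.exp (∑ j ∈ Finset.Icc 1 n, c j / j) := expCoeff_le hc hM hn
    _ = M / n * (Real.exp (∑ j ∈ Finset.Icc 1 n, (c j - θ) / j) *
          Real.exp (∑ j ∈ Finset.Icc 1 n, θ / j)) := by
        rw [← Real.exp_add, ← Finset.sum_add_distrib]
        congr 3
        funext j
        ring
    _ ≤ M / n * (Real.exp (∑ j ∈ Finset.Icc 1 n, (c j - θ) / j) * (C * (n * ewensCoeff θ n))) := by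
        gcongr
        exact h n hn
    _ = _ := by field_simp

end Asymptotics

/-! ### The coefficients that generate factorial moments. -/

section FactorialCoefficients

open Polynomial in
/-- The coefficient of `x ^ m * t ^ l` in `exp (θ * ∑ j, ((1 + t) ^ β j - 1) * x ^ j / j)`. -/
def factCoeff (θ : ℝ) (β : ℕ → ℕ) (l m : ℕ) : ℝ :=
  (expCoeff (fun j => (C θ * ((1 + X) ^ β j - 1) : ℝ[X])) m).coeff l

lemma coeff_one_add_X_pow_sub_one (θ : ℝ) (k l : ℕ) :
    (Polynomial.C θ * ((1 + Polynomial.X) ^ k - 1) : Polynomial ℝ).coeff l =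
      if l = 0 then 0 else θ * k.choose l := by
  rw [Polynomial.coeff_C_mul, Polynomial.coeff_sub, Polynomial.coeff_one_add_X_pow,
    Polynomial.coeff_one]
  split_ifs with h
  · simp [h]
  · rw [sub_zero]

lemma coeff_expCoeff_nonneg {c : ℕ → Polynomial ℝ} (hc : ∀ j l, 0 ≤ (c j).coeff l) (m l : ℕ) :
    0 ≤ (expCoeff c m).coeff l := by
  induction m using Nat.strong_induction_on generalizing l with
  | _ m ih =>
    cases m with
    | zero =>
      rw [expCoeff_zero, Polynomial.coeff_one]
      split_ifs <;> norm_num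
    | succ m =>
      rw [expCoeff, Polynomial.coeff_smul, Polynomial.finsetSum_coeff]
      refine smul_nonneg (by positivity) (Finset.sum_nonneg fun i _ => ?_)
      rw [Polynomial.coeff_mul]
      exact Finset.sum_nonneg fun x _ => mul_nonneg (hc _ _) (ih i i.2 _)

lemma factCoeff_nonneg {θ : ℝ} (hθ : 0 < θ) (β : ℕ → ℕ) (l m : ℕ) : 0 ≤ factCoeff θ β l m :=
  coeff_expCoeff_nonneg (fun j l => by
    rw [coeff_one_add_X_pow_sub_one]
    split_ifs <;> positivity) m l

/-- A nonnegative coefficient of a polynomial in `t` with nonnegative coefficients is at most its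
value at `t = 1`. -/
lemma factCoeff_le_expCoeff {θ : ℝ} (hθ : 0 < θ) (β : ℕ → ℕ) (l m : ℕ) :
    factCoeff θ β l m ≤ expCoeff (fun j => θ * (2 ^ β j - 1)) m := by
  have h := map_expCoeff (Polynomial.aeval (1 : ℝ))
    (fun j => (Polynomial.C θ * ((1 + Polynomial.X) ^ β j - 1) : Polynomial ℝ)) m
  have h2 : (fun j => Polynomial.aeval (1 : ℝ)
      (Polynomial.C θ * ((1 + Polynomial.X) ^ β j - 1) : Polynomial ℝ)) =
      fun j => θ * (2 ^ β j - 1) := by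
    funext j
    simp only [Polynomial.coe_aeval_eq_eval, Polynomial.eval_mul, Polynomial.eval_C,
      Polynomial.eval_sub, Polynomial.eval_pow, Polynomial.eval_add, Polynomial.eval_one,
      Polynomial.eval_X]
    norm_num
  rw [h2] at h
  rw [← h, Polynomial.coe_aeval_eq_eval, Polynomial.eval_eq_sum_range]
  simp only [one_pow, mul_one]
  by_cases hl : l ∈ Finset.range ((expCoeff (fun j =>
    (Polynomial.C θ * ((1 + Polynomial.X) ^ β j - 1) : Polynomial ℝ)) m).natDegree + 1)
  · exact Finset.single_le_sum (f := fun l => factCoeff θ β l m)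
      (fun i _ => factCoeff_nonneg hθ β i m) hl
  · rw [factCoeff, Polynomial.coeff_eq_zero_of_natDegree_lt (by simpa using hl)]
    exact Finset.sum_nonneg fun i _ => factCoeff_nonneg hθ β i m

lemma expCoeff_zero_fun {R : Type*} [CommRing R] [Algebra ℝ R] (m : ℕ) :
    expCoeff (fun _ => (0 : R)) m = if m = 0 then 1 else 0 := by
  cases m with
  | zero => simp
  | succ m => simp [expCoeff]

lemma factCoeff_zero (θ : ℝ) (β : ℕ → ℕ) (m : ℕ) :
    factCoeff θ β 0 m = if m = 0 then 1 else 0 := by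
  have h := map_expCoeff (Polynomial.aeval (0 : ℝ))
    (fun j => (Polynomial.C θ * ((1 + Polynomial.X) ^ β j - 1) : Polynomial ℝ)) m
  rw [factCoeff, Polynomial.coeff_zero_eq_eval_zero, ← Polynomial.coe_aeval_eq_eval, h,
    ← expCoeff_zero_fun (R := ℝ)]
  congr 1
  funext j
  simp [Polynomial.coe_aeval_eq_eval]

/-- Differentiate the exponential in `t` and take the coefficient of `t ^ l`. -/
lemma succ_mul_factCoeff (θ : ℝ) (β : ℕ → ℕ) (l m : ℕ) :
    (l + 1) * factCoeff θ β (l + 1) m = ∑ j ∈ Finset.Icc 1 m, ∑ i ∈ Finset.range (l + 1),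
      θ * ((i + 1) * (β j).choose (i + 1)) / j * factCoeff θ β (l - i) (m - j) := by
  have h := congrArg (fun p => Polynomial.coeff p l) (derivation_expCoeff Polynomial.derivative'
    (fun j => (Polynomial.C θ * ((1 + Polynomial.X) ^ β j - 1) : Polynomial ℝ)) m)
  simp only [Polynomial.derivative'_apply, Polynomial.finsetSum_coeff,
    Polynomial.coeff_derivative] at h
  rw [factCoeff, mul_comm, h]
  refine Finset.sum_congr rfl fun j _ => ?_
  rw [smul_mul_assoc, Polynomial.coeff_smul, Polynomial.coeff_mul,
    Finset.Nat.sum_antidiagonal_eq_sum_range_succ_mk, smul_eq_mul, Finset.mul_sum]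
  refine Finset.sum_congr rfl fun i _ => ?_
  rw [Polynomial.coeff_derivative, coeff_one_add_X_pow_sub_one, if_neg (Nat.succ_ne_zero i),
    factCoeff]
  ring

lemma factCoeff_one (θ : ℝ) (β : ℕ → ℕ) {m : ℕ} (hm : 1 ≤ m) :
    factCoeff θ β 1 m = θ * β m / m := by
  have h := succ_mul_factCoeff θ β 0 m
  rw [Finset.sum_eq_single m] at h
  · simpa [factCoeff_zero] using h
  · intro j hj hne
    rw [Finset.mem_Icc] at hj
    simp [factCoeff_zero, show m - j ≠ 0 by omega]
  · intro h
    exact absurd (Finset.mem_Icc.2 ⟨hm, le_rfl⟩) h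

end FactorialCoefficients

/-! ### Means under the Ewens measure and generating functions. -/

section Mean

/-- The mean of `f` under the Ewens measure. -/
def ewensMean (θ : ℝ) (n : ℕ) (f : Equiv.Perm (Fin n) → ℝ) : ℝ :=
  (∑ σ, θ ^ numCycles σ * f σ) / risingFactorial θ n

lemma ewensProb_eq_ewensMean (θ : ℝ) (n : ℕ) (A : Set (Equiv.Perm (Fin n))) :
    ewensProb θ n A = ewensMean θ n (A.indicator 1) := by
  classical
  rw [ewensProb, ewensMean]
  congr 1
  refine Finset.sum_congr rfl fun σ _ => ?_
  by_cases h : σ ∈ A <;> simp [h]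

lemma ewensMean_mono {θ : ℝ} (hθ : 0 < θ) {n : ℕ} {f g : Equiv.Perm (Fin n) → ℝ}
    (h : ∀ σ, f σ ≤ g σ) : ewensMean θ n f ≤ ewensMean θ n g :=
  div_le_div_of_nonneg_right (Finset.sum_le_sum fun σ _ =>
    mul_le_mul_of_nonneg_left (h σ) (by positivity)) (risingFactorial_pos hθ n).le

lemma ewensMean_add (θ : ℝ) {n : ℕ} (f g : Equiv.Perm (Fin n) → ℝ) :
    ewensMean θ n (fun σ => f σ + g σ) = ewensMean θ n f + ewensMean θ n g := by
  simp only [ewensMean, mul_add, Finset.sum_add_distrib, add_div]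

lemma ewensMean_const_mul (θ : ℝ) {n : ℕ} (r : ℝ) (f : Equiv.Perm (Fin n) → ℝ) :
    ewensMean θ n (fun σ => r * f σ) = r * ewensMean θ n f := by
  simp only [ewensMean, mul_left_comm _ r, ← Finset.mul_sum, mul_div_assoc]

lemma ewensMean_sum (θ : ℝ) {n : ℕ} {ι : Type*} (s : Finset ι) (f : ι → Equiv.Perm (Fin n) → ℝ) :
    ewensMean θ n (fun σ => ∑ i ∈ s, f i σ) = ∑ i ∈ s, ewensMean θ n (f i) := by
  simp only [ewensMean, Finset.mul_sum]
  rw [Finset.sum_comm, Finset.sum_div]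

lemma ewensMean_nonneg {θ : ℝ} (hθ : 0 < θ) {n : ℕ} {f : Equiv.Perm (Fin n) → ℝ}
    (h : ∀ σ, 0 ≤ f σ) : 0 ≤ ewensMean θ n f :=
  div_nonneg (Finset.sum_nonneg fun σ _ => mul_nonneg (by positivity) (h σ))
    (risingFactorial_pos hθ n).le

lemma sum_pow_numCycles_mul_prod {R : Type*} [CommRing R] [Algebra ℝ R] (t : R) (n : ℕ)
    (c : ℕ → R) :
    ∑ σ : Equiv.Perm (Fin n), t ^ numCycles σ * ∏ j ∈ Finset.Icc 1 n, c j ^ cycleCount σ j =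
      (n.factorial : ℝ) • expCoeff (fun j => t * c j) n := by
  rw [← sum_prod_pow_cycleCount]
  refine Finset.sum_congr rfl fun σ _ => ?_
  rw [prod_pow_cycleCount, prod_pow_cycleCount, Multiset.prod_map_mul, Multiset.map_const',
    Multiset.prod_replicate, numCycles]

lemma pow_additiveFun {R : Type*} [CommRing R] (z : R) (b : ℕ → ℕ → ℕ) (n : ℕ)
    (σ : Equiv.Perm (Fin n)) :
    z ^ additiveFun b n σ = ∏ j ∈ Finset.Icc 1 n, (z ^ b n j) ^ cycleCount σ j := by
  simp only [additiveFun, ← pow_mul, Finset.prod_pow_eq_pow_sum]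

/-- The probability generating function of an additive function. -/
lemma ewensMean_pow_additiveFun (θ : ℝ) (b : ℕ → ℕ → ℕ) (n : ℕ) (z : ℝ) :
    ewensMean θ n (fun σ => z ^ additiveFun b n σ) =
      expCoeff (fun j => θ * z ^ b n j) n / ewensCoeff θ n := by
  simp only [ewensMean, pow_additiveFun, sum_pow_numCycles_mul_prod, smul_eq_mul]
  rw [ewensCoeff]
  have : ((n.factorial : ℕ) : ℝ) ≠ 0 := by positivity
  field_simp

lemma ewensMean_one {θ : ℝ} (hθ : 0 < θ) (n : ℕ) : ewensMean θ n (fun _ => 1) = 1 := by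
  have h := ewensMean_pow_additiveFun θ (fun _ _ => 0) n 1
  simp only [one_pow, mul_one, expCoeff_const] at h
  rw [h, div_self (ewensCoeff_pos hθ n).ne']

lemma ewensMean_choose {θ : ℝ} (b : ℕ → ℕ → ℕ) (n l : ℕ) :
    ewensMean θ n (fun σ => ((additiveFun b n σ).choose l : ℝ)) =
      ∑ m ∈ Finset.range (n + 1),
        factCoeff θ (b n) l m * (ewensCoeff θ (n - m) / ewensCoeff θ n) := by
  have h := sum_pow_numCycles_mul_prod (Polynomial.C θ) n
    (fun j => ((1 + Polynomial.X) ^ b n j : Polynomial ℝ))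
  -- The constant summand `θ` contributes the factor `(1 - x) ^ (-θ)`, so the coefficient becomes a
  -- convolution.
  have h1 : (fun j => (Polynomial.C θ * (1 + Polynomial.X) ^ b n j : Polynomial ℝ)) =
      fun j => Polynomial.C θ * ((1 + Polynomial.X) ^ b n j - 1) + Polynomial.C θ := by
    funext j
    ring
  have h2 : ∀ k, expCoeff (fun _ => Polynomial.C θ) k = Polynomial.C (ewensCoeff θ k) := by
    intro k
    have := map_expCoeff (Algebra.ofId ℝ (Polynomial ℝ)) (fun _ => θ) k
    rw [expCoeff_const] at this
    exact this.symm
  rw [h1, expCoeff_add] at h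
  have h3 := congrArg (fun p => Polynomial.coeff p l) h
  simp only [← pow_additiveFun, Polynomial.finsetSum_coeff, ← Polynomial.C_pow,
    Polynomial.coeff_C_mul, Polynomial.coeff_one_add_X_pow, Polynomial.coeff_smul, h2,
    Polynomial.coeff_mul_C, smul_eq_mul] at h3
  rw [ewensMean, h3]
  simp only [factCoeff, ← mul_div_assoc]
  rw [← Finset.sum_div, show ewensCoeff θ n = risingFactorial θ n / n.factorial from rfl]
  have : ((n.factorial : ℕ) : ℝ) ≠ 0 := by positivity
  field_simp

end Mean

/-! ### The tuple sums defining `Υ_n(l)`. -/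

section TupleSums

lemma sum_piFinset_succ {M : Type*} [AddCommMonoid M] {u : ℕ} (S : Finset ℕ)
    (g : (Fin (u + 1) → ℕ) → M) :
    ∑ r ∈ Fintype.piFinset (fun _ : Fin (u + 1) => S), g r =
      ∑ a ∈ S, ∑ r ∈ Fintype.piFinset (fun _ : Fin u => S), g (Fin.cons a r) := by
  rw [← Finset.sum_product']
  refine Finset.sum_bij' (fun r _ => (r 0, Fin.tail r)) (fun p _ => Fin.cons p.1 p.2) ?_ ?_ ?_ ?_ ?_
  · intro r hr
    rw [Fintype.mem_piFinset] at hr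
    exact Finset.mem_product.2 ⟨hr 0, Fintype.mem_piFinset.2 fun i => hr i.succ⟩
  · intro p hp
    rw [Finset.mem_product, Fintype.mem_piFinset] at hp
    exact Fintype.mem_piFinset.2 (Fin.cases hp.1 hp.2)
  · intro r _
    exact Fin.cons_self_tail r
  · intro p _
    simp
  · intro r _
    rw [Fin.cons_self_tail]

/-- The product of binomial coefficients attached to the tuple `r`. -/
def chooseProd (l : ℕ) {u : ℕ} (r : Fin u → ℕ) : ℝ :=
  ∏ i : Fin u, ((l - (∑ k ∈ Finset.univ.filter (fun k => k < i), r k) - 1).choose (r i - 1) : ℝ)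

lemma chooseProd_cons (l a : ℕ) {u : ℕ} (r : Fin u → ℕ) :
    chooseProd l (Fin.cons a r : Fin (u + 1) → ℕ) =
      (l - 1).choose (a - 1) * chooseProd (l - a) r := by
  rw [chooseProd, Fin.prod_univ_succ, chooseProd]
  congr 1
  · simp
  · refine Finset.prod_congr rfl fun i _ => ?_
    rw [Finset.sum_filter, Fin.sum_univ_succ]
    simp [Finset.sum_filter, Nat.sub_add_eq]

/-- The sum over tuples `r_1 + ⋯ + r_u = l` and `j_1, …, j_u ≤ N` in which `j` has weight
`W (j_1 + ⋯ + j_u)`. -/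
def tupleSum (β : ℕ → ℕ) (N K u l : ℕ) (W : ℕ → ℝ) : ℝ :=
  ∑ r ∈ rTuples l K u, chooseProd l r *
    ∑ j ∈ Fintype.piFinset (fun _ : Fin u => Finset.Icc 1 N),
      (∏ i : Fin u, ((β (j i)).descFactorial (r i) : ℝ)) / (∏ i : Fin u, (j i : ℝ)) * W (∑ i, j i)

lemma tupleSum_zero_zero (β : ℕ → ℕ) (N K : ℕ) (W : ℕ → ℝ) : tupleSum β N K 0 0 W = W 0 := by
  have h : rTuples 0 K 0 = Finset.univ := by
    ext r
    simp [rTuples]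
  rw [tupleSum, h, Fintype.sum_unique]
  simp [chooseProd]

lemma tupleSum_eq_zero {β : ℕ → ℕ} {N K u l : ℕ} (h : l < u ∨ u = 0 ∧ 0 < l) (W : ℕ → ℝ) :
    tupleSum β N K u l W = 0 := by
  have he : rTuples l K u = ∅ := by
    ext r
    simp only [rTuples, Finset.mem_filter, Fintype.mem_piFinset, Finset.mem_Icc,
      Finset.notMem_empty, iff_false, not_and]
    intro hr hs
    rcases h with h | ⟨rfl, h⟩
    · have := Finset.sum_le_sum (s := Finset.univ) fun i _ => (hr i).1
      simp at this
      omega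
    · simp at hs
      omega
  rw [tupleSum, he, Finset.sum_empty]

lemma tupleSum_succ (β : ℕ → ℕ) (N K u l : ℕ) (W : ℕ → ℝ) :
    tupleSum β N K (u + 1) l W = ∑ a ∈ Finset.Icc 1 K, if a ≤ l then
      ((l - 1).choose (a - 1) : ℝ) * ∑ j ∈ Finset.Icc 1 N, ((β j).descFactorial a : ℝ) / j *
        tupleSum β N K u (l - a) (fun s => W (j + s)) else 0 := by
  rw [tupleSum, rTuples, Finset.sum_filter, sum_piFinset_succ]
  refine Finset.sum_congr rfl fun a _ => ?_
  simp only [Fin.sum_univ_succ, Fin.cons_zero, Fin.cons_succ]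
  split_ifs with ha
  · simp only [tupleSum, rTuples, Finset.sum_filter, Finset.mul_sum]
    rw [Finset.sum_comm]
    refine Finset.sum_congr rfl fun r _ => ?_
    have hiff : a + ∑ i, r i = l ↔ ∑ i, r i = l - a := by omega
    simp only [hiff]
    split_ifs
    · rw [sum_piFinset_succ]
      refine Finset.sum_congr rfl fun j _ => ?_
      simp only [Finset.mul_sum]
      refine Finset.sum_congr rfl fun js _ => ?_
      rw [chooseProd_cons]
      simp only [Fin.prod_univ_succ, Fin.cons_zero, Fin.cons_succ]
      rw [mul_div_mul_comm]
      ring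
    · simp
  · refine Finset.sum_eq_zero fun r _ => if_neg (by omega)

/-- The sums over tuples compute the factorial coefficients. -/
lemma sum_pow_mul_tupleSum (θ : ℝ) {β : ℕ → ℕ} {N K : ℕ} (hβ : ∀ j, β j ≤ K) (l : ℕ) {W : ℕ → ℝ}
    (hW : ∀ s, N < s → W s = 0) :
    ∑ u ∈ Finset.range (l + 1), θ ^ u * tupleSum β N K u l W =
      l.factorial * ∑ m ∈ Finset.range (N + 1), factCoeff θ β l m * W m := by
  induction l using Nat.strong_induction_on generalizing W with
  | _ l ih =>
    cases l with
    | zero => simp [tupleSum_zero_zero, factCoeff_zero]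
    | succ l =>
      -- Peel off `r_1 = i + 1` and `j_1 = j`: what remains is the same sum for `l - i` with the
      -- shifted weight `W (j + ·)`, which is why the induction generalises over `W`.
      have hL : ∑ u ∈ Finset.range (l + 1 + 1), θ ^ u * tupleSum β N K u (l + 1) W =
          ∑ i ∈ Finset.range (l + 1), (l.choose i : ℝ) * ∑ j ∈ Finset.Icc 1 N,
            θ * ((β j).descFactorial (i + 1) : ℝ) / j * ((l - i).factorial *
              ∑ k ∈ Finset.range (N + 1), factCoeff θ β (l - i) k * W (j + k)) := by
        rw [Finset.sum_range_succ', tupleSum_eq_zero (Or.inr ⟨rfl, Nat.succ_pos l⟩), mul_zero,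
          add_zero]
        have h1 : ∀ u, θ ^ (u + 1) * tupleSum β N K (u + 1) (l + 1) W =
            ∑ i ∈ Finset.range (l + 1), (l.choose i : ℝ) * ∑ j ∈ Finset.Icc 1 N,
              θ * ((β j).descFactorial (i + 1) : ℝ) / j *
                (θ ^ u * tupleSum β N K u (l - i) (fun s => W (j + s))) := by
          intro u
          rw [tupleSum_succ, ← Finset.sum_filter]
          have h2 : ∑ a ∈ (Finset.Icc 1 K).filter (· ≤ l + 1),
              (((l + 1 - 1).choose (a - 1) : ℝ) * ∑ j ∈ Finset.Icc 1 N,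
                ((β j).descFactorial a : ℝ) / j *
                  tupleSum β N K u (l + 1 - a) (fun s => W (j + s))) =
              ∑ a ∈ Finset.Icc 1 (l + 1),
              (((l + 1 - 1).choose (a - 1) : ℝ) * ∑ j ∈ Finset.Icc 1 N,
                ((β j).descFactorial a : ℝ) / j *
                  tupleSum β N K u (l + 1 - a) (fun s => W (j + s))) := by
            -- The restriction `r_1 ≤ K` may be dropped, since the falling factorial vanishes beyond
            -- `β j ≤ K`.
            refine Finset.sum_subset ?_ ?_
            · intro a ha
              simp only [Finset.mem_filter, Finset.mem_Icc] at ha ⊢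
              omega
            · intro a ha ha'
              simp only [Finset.mem_filter, Finset.mem_Icc] at ha ha'
              rw [Finset.sum_eq_zero, mul_zero]
              intro j _
              rw [Nat.descFactorial_eq_zero_iff_lt.2 (by have := hβ j; omega)]
              simp
          rw [h2, Finset.mul_sum]
          refine Finset.sum_nbij' (· - 1) (· + 1) ?_ ?_ ?_ ?_ ?_ <;> intro a ha <;>
            simp only [Finset.mem_range, Finset.mem_Icc, add_tsub_cancel_right] at ha ⊢ <;>
            try omega
          obtain ⟨i, rfl⟩ := Nat.exists_eq_add_of_le' ha.1
          rw [Nat.add_sub_cancel, Nat.add_sub_add_right, mul_left_comm, Finset.mul_sum]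
          congr 1
          refine Finset.sum_congr rfl fun j _ => ?_
          ring
        simp only [h1]
        rw [Finset.sum_comm]
        refine Finset.sum_congr rfl fun i hi => ?_
        rw [Finset.mem_range] at hi
        rw [← Finset.mul_sum, Finset.sum_comm]
        congr 1
        refine Finset.sum_congr rfl fun j _ => ?_
        rw [← Finset.mul_sum]
        congr 1
        rw [← ih (l - i) (by omega) (W := fun s => W (j + s)) fun s hs => hW _ (by omega)]
        symm
        refine Finset.sum_subset (Finset.range_mono (by omega)) fun u _ hu => ?_
        rw [Finset.mem_range] at hu
        rw [tupleSum_eq_zero (Or.inl (by omega)), mul_zero]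
      have hR : ((l + 1).factorial : ℝ) * ∑ m ∈ Finset.range (N + 1),
            factCoeff θ β (l + 1) m * W m =
          ∑ j ∈ Finset.Icc 1 N, ∑ k ∈ Finset.range (N + 1), ∑ i ∈ Finset.range (l + 1),
            l.factorial * (θ * ((i + 1) * (β j).choose (i + 1)) / j *
              factCoeff θ β (l - i) k * W (j + k)) := by
        have h1 : ∀ m, ((l + 1).factorial : ℝ) * (factCoeff θ β (l + 1) m * W m) =
            ∑ j ∈ Finset.Icc 1 m, ∑ i ∈ Finset.range (l + 1),
              l.factorial * (θ * ((i + 1) * (β j).choose (i + 1)) / j *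
                factCoeff θ β (l - i) (m - j) * W (j + (m - j))) := by
          intro m
          have h2 := succ_mul_factCoeff θ β l m
          rw [Nat.factorial_succ]
          push_cast
          rw [show ((l : ℝ) + 1) * l.factorial * (factCoeff θ β (l + 1) m * W m) =
            l.factorial * (((l : ℝ) + 1) * factCoeff θ β (l + 1) m * W m) by ring, h2,
            Finset.sum_mul, Finset.mul_sum]
          refine Finset.sum_congr rfl fun j hj => ?_
          rw [Finset.mem_Icc] at hj
          rw [Finset.sum_mul, Finset.mul_sum, Nat.add_sub_cancel' hj.2]
        rw [Finset.mul_sum]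
        simp only [h1]
        rw [sum_range_sum_Icc (fun j k => ∑ i ∈ Finset.range (l + 1),
              l.factorial * (θ * ((i + 1) * (β j).choose (i + 1)) / j *
                factCoeff θ β (l - i) k * W (j + k)))]
        refine Finset.sum_congr rfl fun j _ => ?_
        refine Finset.sum_subset (Finset.range_mono (Nat.sub_le _ _)) fun k _ hk => ?_
        rw [Finset.mem_range] at hk
        rw [hW (j + k) (by omega)]
        simp
      rw [hL, hR]
      simp only [Finset.mul_sum]
      rw [Finset.sum_comm]
      refine Finset.sum_congr rfl fun j _ => ?_
      rw [Finset.sum_comm]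
      refine Finset.sum_congr rfl fun k _ => Finset.sum_congr rfl fun i hi => ?_
      rw [Finset.mem_range] at hi
      -- The two sides agree term by term through `l ! = l.choose i * i ! * (l - i) !`.
      have hc := Nat.choose_mul_factorial_mul_factorial (Nat.lt_succ_iff.1 hi)
      rw [Nat.descFactorial_eq_factorial_mul_choose, Nat.factorial_succ, ← hc]
      push_cast
      ring

lemma Upsilon_eq_sum_factCoeff (θ : ℝ) (a : ℕ → ℕ → ℕ) (n K : ℕ) {l : ℕ} (hl : 1 ≤ l) :
    Upsilon θ a n l K = l.factorial * ∑ m ∈ Finset.range n,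
      factCoeff θ (fun j => min (a n j) K) l m * (1 - (m : ℝ) / n) ^ (θ - 1) := by
  -- The weight is cut off explicitly: at `s = n` the power `0 ^ (θ - 1)` equals `1` when `θ = 1`.
  have h := sum_pow_mul_tupleSum θ (β := fun j => min (a n j) K) (N := n) (K := K)
    (fun j => min_le_right _ _) l (W := fun s => if s < n then (1 - (s : ℝ) / n) ^ (θ - 1) else 0)
    fun s hs => if_neg (by omega)
  have h0 : ∀ m, factCoeff θ (fun j => min (a n j) K) l m *
      (if m < n then (1 - (m : ℝ) / n) ^ (θ - 1) else 0) = if m < n then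
        factCoeff θ (fun j => min (a n j) K) l m * (1 - (m : ℝ) / n) ^ (θ - 1) else 0 := fun m => by
    split_ifs <;> simp
  simp only [h0] at h
  rw [Finset.sum_range_succ _ n, if_neg (lt_irrefl n), add_zero, Finset.sum_congr rfl fun m hm =>
    if_pos (Finset.mem_range.1 hm)] at h
  rw [← h, Finset.sum_range_succ', tupleSum_eq_zero (Or.inr ⟨rfl, hl⟩), mul_zero, add_zero, Upsilon]
  symm
  refine Finset.sum_nbij' (· + 1) (· - 1) ?_ ?_ ?_ ?_ ?_ <;> intro u hu <;>
    simp only [Finset.mem_range, Finset.mem_Icc] at hu ⊢ <;> try omega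
  rw [tupleSum]
  congr 1
  refine Finset.sum_congr rfl fun r _ => ?_
  rw [chooseProd, jTuples, Finset.sum_filter]
  congr 1
  refine Finset.sum_congr rfl fun j _ => ?_
  split_ifs
  · push_cast
    rfl
  · simp

end TupleSums

/-! ### Uniform estimates in terms of the size of the support. -/

section BoundedSupport

/-- The sum of `1 / j` over the `j ≤ n` with `β j ≠ 0`. -/
def suppSum (β : ℕ → ℕ) (n : ℕ) : ℝ :=
  ∑ j ∈ Finset.Icc 1 n, (if 1 ≤ β j then (1 : ℝ) else 0) / j

lemma sum_pow_sub_one_div_le {θ z : ℝ} (hθ : 0 < θ) (hz : 1 ≤ z) {β : ℕ → ℕ} {K : ℕ}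
    (hβ : ∀ j, β j ≤ K) {m n : ℕ} (hmn : m ≤ n) :
    ∑ j ∈ Finset.Icc 1 m, θ * (z ^ β j - 1) / j ≤ θ * z ^ K * suppSum β n := by
  have hz0 : 0 ≤ z := by linarith
  calc ∑ j ∈ Finset.Icc 1 m, θ * (z ^ β j - 1) / j
      ≤ ∑ j ∈ Finset.Icc 1 m, θ * z ^ K * ((if 1 ≤ β j then (1 : ℝ) else 0) / j) := by
        refine Finset.sum_le_sum fun j _ => ?_
        split_ifs with h
        · rw [mul_div_assoc', mul_one]
          gcongr
          have := pow_le_pow_right₀ hz (hβ j)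
          linarith
        · rw [show β j = 0 by omega]
          simp
    _ = θ * z ^ K * ∑ j ∈ Finset.Icc 1 m, (if 1 ≤ β j then (1 : ℝ) else 0) / j := by
        rw [Finset.mul_sum]
    _ ≤ θ * z ^ K * suppSum β n := by
        refine mul_le_mul_of_nonneg_left (Finset.sum_le_sum_of_subset_of_nonneg
          (Finset.Icc_subset_Icc_right hmn) fun j _ _ => ?_) (by positivity)
        split_ifs <;> positivity

/-- Only the `j` in the support contribute to `∑ θ (z ^ b - 1) / j`, each at most `θ z ^ K / j`.
These uniform exponential moments are the source of all dominating sequences below. -/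
lemma exists_ewensMean_pow_le {θ z : ℝ} (hθ : 0 < θ) (hz : 1 ≤ z) (K : ℕ) (B : ℝ) :
    ∃ C : ℝ, 0 < C ∧ ∀ (b : ℕ → ℕ → ℕ) (n : ℕ), (∀ j, b n j ≤ K) → 1 ≤ n → suppSum (b n) n ≤ B →
      ewensMean θ n (fun σ => z ^ additiveFun b n σ) ≤ C := by
  obtain ⟨C, hC, h⟩ := exists_expCoeff_div_ewensCoeff_le hθ
  refine ⟨C * (θ * z ^ K) * Real.exp (θ * z ^ K * B), by positivity, fun b n hb hn hB => ?_⟩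
  rw [ewensMean_pow_additiveFun]
  refine (h (fun j => θ * z ^ b n j) (θ * z ^ K) (fun j => by positivity)
    (fun j => mul_le_mul_of_nonneg_left (pow_le_pow_right₀ hz (hb j)) hθ.le) n hn).trans ?_
  refine mul_le_mul_of_nonneg_left (Real.exp_le_exp.2 ?_) (by positivity)
  have h1 := sum_pow_sub_one_div_le hθ hz hb le_rfl (m := n) (n := n)
  simp only [mul_sub, mul_one] at h1
  exact h1.trans (mul_le_mul_of_nonneg_left hB (by positivity))

lemma exists_factCoeff_le {θ : ℝ} (hθ : 0 < θ) (K : ℕ) (B : ℝ) :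
    ∃ C : ℝ, 0 < C ∧ ∀ (β : ℕ → ℕ) (n m l : ℕ), (∀ j, β j ≤ K) → 1 ≤ m → m ≤ n → suppSum β n ≤ B →
      factCoeff θ β l m ≤ C / m := by
  refine ⟨θ * 2 ^ K * Real.exp (θ * 2 ^ K * B), by positivity, fun β n m l hβ hm hmn hB => ?_⟩
  refine (factCoeff_le_expCoeff hθ β l m).trans ?_
  have h1 : ∀ j, (1 : ℝ) ≤ 2 ^ β j := fun j => one_le_pow₀ one_le_two
  refine (expCoeff_le (M := θ * 2 ^ K) (fun j => mul_nonneg hθ.le (sub_nonneg.2 (h1 j)))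
    (fun j => mul_le_mul_of_nonneg_left ?_ hθ.le) hm).trans ?_
  · have := pow_le_pow_right₀ (one_le_two (α := ℝ)) (hβ j)
    linarith
  · rw [div_mul_eq_mul_div]
    gcongr
    exact (sum_pow_sub_one_div_le hθ one_le_two hβ hmn).trans
      (mul_le_mul_of_nonneg_left hB (by positivity))

/-- `t ^ l * h.choose l` is one term of the binomial expansion of `(t + 1) ^ h`. -/
lemma ewensMean_choose_le {θ : ℝ} (hθ : 0 < θ) (b : ℕ → ℕ → ℕ) (n l : ℕ) {t : ℝ} (ht : 0 < t) :
    ewensMean θ n (fun σ => ((additiveFun b n σ).choose l : ℝ)) ≤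
      (t ^ l)⁻¹ * ewensMean θ n (fun σ => (t + 1) ^ additiveFun b n σ) := by
  rw [← ewensMean_const_mul]
  refine ewensMean_mono hθ fun σ => ?_
  rw [le_inv_mul_iff₀ (by positivity), add_pow]
  by_cases hl : l ≤ additiveFun b n σ
  · have := Finset.single_le_sum
      (f := fun m => t ^ m * 1 ^ (additiveFun b n σ - m) * ((additiveFun b n σ).choose m : ℝ))
      (fun i _ => by positivity) (Finset.mem_range.2 (Nat.lt_succ_of_le hl))
    simpa using this
  · rw [Nat.choose_eq_zero_of_lt (by omega), Nat.cast_zero, mul_zero]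
    exact Finset.sum_nonneg fun i _ => by positivity

lemma sum_ite_lt_add_le {n N : ℕ} {c : ℝ} (hc : 0 ≤ c) :
    ∑ m ∈ Finset.range n, (if n < m + N then c else 0) ≤ N * c := by
  rw [← Finset.sum_filter, Finset.sum_const, nsmul_eq_mul]
  refine mul_le_mul_of_nonneg_right ?_ hc
  have : ((Finset.range n).filter fun m => n < m + N) ⊆ Finset.Ico (n - N) n := by
    intro m hm
    simp only [Finset.mem_filter, Finset.mem_range, Finset.mem_Ico] at hm ⊢
    omega
  have h := Finset.card_le_card this
  rw [Nat.card_Ico] at h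
  exact_mod_cast h.trans (by omega)

/-- The weights `(1 - m / n) ^ (θ - 1)` may replace the exact ones in the limit. -/
lemma tendsto_ewensMean_choose_sub {θ : ℝ} (hθ : 0 < θ) {b : ℕ → ℕ → ℕ} {K : ℕ}
    (hb : ∀ n j, b n j ≤ K) {B : ℝ} (hB : ∀ᶠ n in atTop, suppSum (b n) n ≤ B) (l : ℕ) :
    Tendsto (fun n => ewensMean θ n (fun σ => ((additiveFun b n σ).choose l : ℝ)) -
      ∑ m ∈ Finset.range n, factCoeff θ (b n) l m * (1 - (m : ℝ) / n) ^ (θ - 1))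
      atTop (𝓝 0) := by
  obtain ⟨C₁, hC₁, h₁⟩ := exists_ewensCoeff_div_bounds hθ
  obtain ⟨C₂, hC₂, h₂⟩ := exists_ewensMean_pow_le hθ (one_le_two (α := ℝ)) K B
  obtain ⟨C₃, hC₃, h₃⟩ := exists_factCoeff_le hθ K B
  rw [Metric.tendsto_nhds]
  intro δ hδ
  -- Chosen so that the relative error `ε` on the terms with `m + N ≤ n` costs at most `δ / 2` in
  -- total, as the weighted sum is at most `C₁ * C₂`.
  set ε : ℝ := δ / (2 * (C₁ * C₂)) with hε
  obtain ⟨N, hN, hap⟩ := exists_abs_ewensCoeff_div_sub_le hθ (show 0 < ε by positivity)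
  set D : ℝ := ∑ k ∈ Finset.range N, ewensCoeff θ k with hD
  have hD0 : 0 ≤ D := Finset.sum_nonneg fun k _ => (ewensCoeff_pos hθ k).le
  set C₄ : ℝ := N * (2 * C₃ * ((1 + C₁) * D)) + C₃ with hC₄
  have hlim : Tendsto (fun n : ℕ => C₄ / (n * ewensCoeff θ n)) atTop (𝓝 0) :=
    (tendsto_natCast_mul_ewensCoeff hθ).const_div_atTop C₄
  filter_upwards [hB, eventually_ge_atTop (2 * N), hlim.eventually_lt_const (half_pos hδ)]
    with n hBn hnN hlimn
  have hn : 1 ≤ n := by omega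
  have hn' : (0 : ℝ) < n := by exact_mod_cast hn
  have hdn := ewensCoeff_pos hθ n
  set f : ℕ → ℝ := factCoeff θ (b n) l with hf
  set ρ : ℕ → ℝ := fun m => ewensCoeff θ (n - m) / ewensCoeff θ n with hρ
  set w : ℕ → ℝ := fun m => (1 - (m : ℝ) / n) ^ (θ - 1) with hw
  have hf0 : ∀ m, 0 ≤ f m := factCoeff_nonneg hθ (b n) l
  have hρ0 : ∀ m, 0 ≤ ρ m := fun m => (div_pos (ewensCoeff_pos hθ _) hdn).le
  have hw0 : ∀ m, m < n → 0 ≤ w m := fun m hm => (rpow_one_sub_div_pos hm _).le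
  have hE : ewensMean θ n (fun σ => ((additiveFun b n σ).choose l : ℝ)) =
      ∑ m ∈ Finset.range n, f m * ρ m + f n * ρ n := by
    rw [ewensMean_choose, Finset.sum_range_succ]
  have hE2 : ewensMean θ n (fun σ => ((additiveFun b n σ).choose l : ℝ)) ≤ C₂ := by
    refine (ewensMean_choose_le hθ b n l one_pos).trans ?_
    rw [one_pow, inv_one, one_mul, one_add_one_eq_two]
    exact h₂ b n (hb n) hn hBn
  have hfw : ∑ m ∈ Finset.range n, f m * w m ≤ C₁ * C₂ := by
    calc ∑ m ∈ Finset.range n, f m * w m ≤ ∑ m ∈ Finset.range n, C₁ * (f m * ρ m) := by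
          refine Finset.sum_le_sum fun m hm => ?_
          rw [mul_left_comm]
          exact mul_le_mul_of_nonneg_left (h₁ n m (Finset.mem_range.1 hm)).2 (hf0 m)
      _ = C₁ * ∑ m ∈ Finset.range n, f m * ρ m := by rw [Finset.mul_sum]
      _ ≤ C₁ * C₂ := by
          refine mul_le_mul_of_nonneg_left (le_trans ?_ hE2) hC₁.le
          rw [hE]
          exact le_add_of_nonneg_right (mul_nonneg (hf0 n) (hρ0 n))
  have hlast : f n * ρ n ≤ C₃ / (n * ewensCoeff θ n) := by
    have := h₃ (b n) n n l (hb n) hn le_rfl hBn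
    calc f n * ρ n ≤ C₃ / n * ρ n := mul_le_mul_of_nonneg_right this (hρ0 n)
      _ = _ := by simp only [hρ, Nat.sub_self, ewensCoeff_zero]; field_simp
  -- Bounds each of the at most `N` terms near `m = n`: there `m ≥ n / 2`, so `f m ≤ 2 * C₃ / n`,
  -- and `D` dominates `ewensCoeff θ (n - m)`.
  set c : ℝ := 2 * C₃ * ((1 + C₁) * D) / (n * ewensCoeff θ n) with hc
  have hc0 : 0 ≤ c := by positivity
  have hterm : ∀ m ∈ Finset.range n,
      |f m * ρ m - f m * w m| ≤ ε * (f m * w m) + if n < m + N then c else 0 := by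
    intro m hm
    have hmn := Finset.mem_range.1 hm
    rw [← mul_sub, abs_mul, abs_of_nonneg (hf0 m)]
    split_ifs with h
    · have hfm : f m ≤ 2 * C₃ / n := by
        refine (h₃ (b n) n m l (hb n) (by omega) hmn.le hBn).trans ?_
        have hm0 : (0 : ℝ) < m := by exact_mod_cast (by omega : 0 < m)
        have h2m : (n : ℝ) ≤ 2 * m := by exact_mod_cast (by omega : n ≤ 2 * m)
        rw [div_le_div_iff₀ hm0 hn']
        nlinarith
      have hρm : ρ m ≤ D / ewensCoeff θ n := by
        refine div_le_div_of_nonneg_right ?_ hdn.le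
        exact Finset.single_le_sum (f := ewensCoeff θ) (fun k _ => (ewensCoeff_pos hθ k).le)
          (Finset.mem_range.2 (by omega))
      have hab : |ρ m - w m| ≤ (1 + C₁) * ρ m := by
        have := (h₁ n m hmn).2
        rw [abs_le]
        have h0 := hw0 m hmn
        have h1 := hρ0 m
        have h2 := mul_nonneg hC₁.le h1
        constructor <;> linarith
      have h5 : f m * |ρ m - w m| ≤ c := by
        calc f m * |ρ m - w m| ≤ 2 * C₃ / n * ((1 + C₁) * (D / ewensCoeff θ n)) :=
              mul_le_mul hfm (hab.trans (mul_le_mul_of_nonneg_left hρm (by positivity)))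
                (abs_nonneg _) (by positivity)
          _ = c := by rw [hc]; field_simp
      have h6 := mul_nonneg (show 0 ≤ ε by positivity) (mul_nonneg (hf0 m) (hw0 m hmn))
      linarith
    · rw [add_zero, mul_left_comm]
      exact mul_le_mul_of_nonneg_left (hap n m (by omega)) (hf0 m)
  rw [Real.dist_eq, sub_zero, hE, add_sub_right_comm, ← Finset.sum_sub_distrib]
  calc |∑ m ∈ Finset.range n, (f m * ρ m - f m * w m) + f n * ρ n|
      ≤ |∑ m ∈ Finset.range n, (f m * ρ m - f m * w m)| + |f n * ρ n| := abs_add_le _ _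
    _ ≤ ∑ m ∈ Finset.range n, (ε * (f m * w m) + if n < m + N then c else 0) +
          C₃ / (n * ewensCoeff θ n) := by
        rw [abs_of_nonneg (mul_nonneg (hf0 n) (hρ0 n))]
        exact add_le_add ((Finset.abs_sum_le_sum_abs _ _).trans (Finset.sum_le_sum hterm)) hlast
    _ ≤ ε * (C₁ * C₂) + N * c + C₃ / (n * ewensCoeff θ n) := by
        rw [Finset.sum_add_distrib, ← Finset.mul_sum]
        gcongr
        exact sum_ite_lt_add_le hc0
    _ = δ / 2 + C₄ / (n * ewensCoeff θ n) := by
        rw [hε, hC₄, hc]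
        field_simp
        ring
    _ < δ := by linarith

/-- The indicator array of the set where `a` is at least `K`. -/
def largeArray (a : ℕ → ℕ → ℕ) (K : ℕ) (n j : ℕ) : ℕ := if K ≤ a n j then 1 else 0

/-- The array `a` truncated at `K`. -/
def truncArray (a : ℕ → ℕ → ℕ) (K : ℕ) (n j : ℕ) : ℕ := min (a n j) K

/-- The mean number of cycles with large value is comparable to the sum in the hypothesis, except
for the length `j = n`, absent there, which contributes at most `θ / (n * ewensCoeff θ n)`. -/
lemma tendsto_ewensMean_largeArray {θ : ℝ} (hθ : 0 < θ) {a : ℕ → ℕ → ℕ} {K : ℕ}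
    (hbdd : Tendsto
      (fun n : ℕ => ∑ j ∈ Finset.Ico 1 n,
        (if K ≤ a n j then (1 : ℝ) else 0) / (j : ℝ) * (1 - (j : ℝ) / (n : ℝ)) ^ (θ - 1))
      atTop (𝓝 0)) :
    Tendsto (fun n => ewensMean θ n (fun σ => (additiveFun (largeArray a K) n σ : ℝ)))
      atTop (𝓝 0) := by
  obtain ⟨C₁, hC₁, h₁⟩ := exists_ewensCoeff_div_bounds hθ
  have hlim : Tendsto (fun n : ℕ => θ / (n * ewensCoeff θ n)) atTop (𝓝 0) :=
    (tendsto_natCast_mul_ewensCoeff hθ).const_div_atTop θ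
  have hlim2 := (hbdd.const_mul (θ * C₁)).add hlim
  rw [mul_zero, add_zero] at hlim2
  refine tendsto_of_tendsto_of_tendsto_of_le_of_le' tendsto_const_nhds hlim2
    (Eventually.of_forall fun n => ewensMean_nonneg hθ fun σ => by positivity) ?_
  filter_upwards [eventually_ge_atTop 1] with n hn
  have hn' : (0 : ℝ) < n := by exact_mod_cast hn
  have hdn := ewensCoeff_pos hθ n
  have h2 := ewensMean_choose (θ := θ) (largeArray a K) n 1
  simp only [Nat.choose_one_right] at h2
  have hz : factCoeff θ (largeArray a K n) 1 0 = 0 := by simp [factCoeff, Polynomial.coeff_one]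
  have hv : ∀ j, ((largeArray a K n j : ℕ) : ℝ) = if K ≤ a n j then (1 : ℝ) else 0 := fun j => by
    simp [largeArray]
  rw [h2, Finset.sum_range_succ, Finset.range_eq_Ico, Finset.sum_eq_sum_Ico_succ_bot (by omega),
    hz, zero_mul, zero_add, zero_add, Finset.mul_sum]
  refine add_le_add (Finset.sum_le_sum fun j hj => ?_) ?_
  · rw [Finset.mem_Ico] at hj
    rw [factCoeff_one _ _ hj.1, hv]
    calc θ * (if K ≤ a n j then (1 : ℝ) else 0) / j * (ewensCoeff θ (n - j) / ewensCoeff θ n)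
        ≤ θ * (if K ≤ a n j then (1 : ℝ) else 0) / j * (C₁ * (1 - (j : ℝ) / n) ^ (θ - 1)) :=
          mul_le_mul_of_nonneg_left (h₁ n j hj.2).1 (by split_ifs <;> positivity)
      _ = _ := by ring
  · rw [factCoeff_one _ _ hn, hv, Nat.sub_self, ewensCoeff_zero, ← div_div, div_mul_div_comm,
      mul_one, ← div_div]
    refine div_le_div_of_nonneg_right (div_le_div_of_nonneg_right ?_ hn'.le) hdn.le
    split_ifs <;> linarith

lemma additiveFun_truncArray_eq {a : ℕ → ℕ → ℕ} {K n : ℕ} {σ : Equiv.Perm (Fin n)}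
    (h : additiveFun (largeArray a K) n σ = 0) :
    additiveFun (truncArray a K) n σ = additiveFun a n σ := by
  rw [additiveFun, Finset.sum_eq_zero_iff] at h
  refine Finset.sum_congr rfl fun j hj => ?_
  have := h j hj
  rw [largeArray, truncArray] at *
  split_ifs at this with hK
  · rw [one_mul] at this
    rw [this, mul_zero, mul_zero]
  · rw [min_eq_left (by omega)]

/-- Convergence of the first factorial moment bounds the size of the support. -/
lemma suppSum_le {θ : ℝ} (hθ : 0 < θ) (β : ℕ → ℕ) {n : ℕ} (hn : 1 ≤ n) :
    suppSum β n ≤ (θ * min 1 ((1 / 2 : ℝ) ^ (θ - 1)))⁻¹ *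
      ∑ m ∈ Finset.range n, factCoeff θ β 1 m * (1 - (m : ℝ) / n) ^ (θ - 1) + 2 := by
  set c := min 1 ((1 / 2 : ℝ) ^ (θ - 1)) with hc
  have hc0 : 0 < c := lt_min one_pos (Real.rpow_pos_of_pos (by norm_num) _)
  have hn' : (0 : ℝ) < n := by exact_mod_cast hn
  -- For `j ≤ n / 2` the weight is at least `c`, its least possible value on `[1/2, 1]`; for larger
  -- `j` the term is at most `2 / n`, and these add up to at most `2`.
  have hterm : ∀ j ∈ Finset.Icc 1 n, (if 1 ≤ β j then (1 : ℝ) else 0) / j ≤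
      (θ * c)⁻¹ * (if j < n then factCoeff θ β 1 j * (1 - (j : ℝ) / n) ^ (θ - 1) else 0) +
        2 / n := by
    intro j hj
    rw [Finset.mem_Icc] at hj
    have hj' : (0 : ℝ) < j := by exact_mod_cast hj.1
    have h0 : 0 ≤ (θ * c)⁻¹ *
        (if j < n then factCoeff θ β 1 j * (1 - (j : ℝ) / n) ^ (θ - 1) else 0) := by
      refine mul_nonneg (by positivity) ?_
      split_ifs with h
      · exact mul_nonneg (factCoeff_nonneg hθ _ _ _) (rpow_one_sub_div_pos h _).le
      · exact le_rfl
    rcases Nat.lt_or_ge n (2 * j) with h | h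
    · have : (if 1 ≤ β j then (1 : ℝ) else 0) / j ≤ 2 / n := by
        rw [div_le_div_iff₀ hj' hn']
        have : (n : ℝ) < 2 * j := by exact_mod_cast h
        split_ifs <;> linarith
      linarith
    · refine le_add_of_le_of_nonneg ?_ (by positivity)
      have hjn : j < n := by omega
      have h2 : (2 : ℝ) * j ≤ n := by exact_mod_cast h
      rw [if_pos hjn, factCoeff_one _ _ hj.1]
      have hw : c ≤ (1 - (j : ℝ) / n) ^ (θ - 1) := by
        have hx : (1 / 2 : ℝ) ≤ 1 - (j : ℝ) / n := by
          rw [le_sub_comm, div_le_iff₀ hn']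
          linarith
        have hx1 : 1 - (j : ℝ) / n ≤ 1 := by
          rw [sub_le_self_iff]
          positivity
        rcases le_total 1 θ with h1 | h1
        · exact (min_le_right _ _).trans
            (Real.rpow_le_rpow (by norm_num) hx (by linarith))
        · exact (min_le_left _ _).trans
            (Real.one_le_rpow_of_pos_of_le_one_of_nonpos (by linarith) hx1 (by linarith))
      have hβ : (if 1 ≤ β j then (1 : ℝ) else 0) ≤ β j := by
        split_ifs with h
        · exact_mod_cast h
        · positivity
      rw [le_inv_mul_iff₀ (by positivity)]
      calc θ * c * ((if 1 ≤ β j then (1 : ℝ) else 0) / j)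
          = θ * (if 1 ≤ β j then (1 : ℝ) else 0) / j * c := by ring
        _ ≤ _ := by gcongr
  calc suppSum β n ≤ ∑ j ∈ Finset.Icc 1 n, ((θ * c)⁻¹ *
        (if j < n then factCoeff θ β 1 j * (1 - (j : ℝ) / n) ^ (θ - 1) else 0) + 2 / n) :=
        Finset.sum_le_sum hterm
    _ = (θ * c)⁻¹ * ∑ j ∈ Finset.Icc 1 n,
          (if j < n then factCoeff θ β 1 j * (1 - (j : ℝ) / n) ^ (θ - 1) else 0) + 2 := by
        rw [Finset.sum_add_distrib, ← Finset.mul_sum, Finset.sum_const, Nat.card_Icc,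
          Nat.add_sub_cancel, nsmul_eq_mul, mul_div_cancel₀ _ hn'.ne']
    _ ≤ _ := by
        gcongr
        rw [← Finset.sum_filter]
        refine Finset.sum_le_sum_of_subset_of_nonneg (fun j hj => ?_) fun j hj _ => ?_
        · exact Finset.mem_range.2 (Finset.mem_filter.1 hj).2
        · exact mul_nonneg (factCoeff_nonneg hθ _ _ _)
            (rpow_one_sub_div_pos (Finset.mem_range.1 hj) _).le

/-- On the support `(1 / 2) ^ b - 1 ≤ -1 / 2`, so a large support forces `h` to be large. No upper
bound on the array is needed. -/
lemma exists_ewensMean_half_pow_le {θ : ℝ} (hθ : 0 < θ) :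
    ∃ C : ℝ, 0 < C ∧ ∀ (b : ℕ → ℕ → ℕ) (n : ℕ), 1 ≤ n →
      ewensMean θ n (fun σ => (1 / 2 : ℝ) ^ additiveFun b n σ) ≤
        C * Real.exp (-(θ / 2 * suppSum (b n) n)) := by
  obtain ⟨C, hC, h⟩ := exists_expCoeff_div_ewensCoeff_le hθ
  refine ⟨C * θ, by positivity, fun b n hn => ?_⟩
  rw [ewensMean_pow_additiveFun]
  refine (h (fun j => θ * (1 / 2) ^ b n j) θ (fun j => by positivity)
    (fun j => mul_le_of_le_one_right hθ.le (pow_le_one₀ (by norm_num) (by norm_num))) n hn).trans ?_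
  refine mul_le_mul_of_nonneg_left (Real.exp_le_exp.2 ?_) (by positivity)
  rw [suppSum, Finset.mul_sum, ← Finset.sum_neg_distrib]
  refine Finset.sum_le_sum fun j _ => ?_
  rw [mul_div_assoc', ← neg_div]
  refine div_le_div_of_nonneg_right ?_ (by positivity)
  split_ifs with hj
  · have : (1 / 2 : ℝ) ^ b n j ≤ (1 / 2) ^ 1 :=
      pow_le_pow_of_le_one (by norm_num) (by norm_num) hj
    nlinarith
  · rw [show b n j = 0 by omega]
    simp

end BoundedSupport

/-! ### Point probabilities versus factorial moments. -/

section PointProbabilities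

/-- The Ewens probability that an additive function equals `k`. -/
def pointProb (θ : ℝ) (b : ℕ → ℕ → ℕ) (n k : ℕ) : ℝ :=
  ewensMean θ n (fun σ => if additiveFun b n σ = k then 1 else 0)

lemma pointProb_nonneg {θ : ℝ} (hθ : 0 < θ) (b : ℕ → ℕ → ℕ) (n k : ℕ) : 0 ≤ pointProb θ b n k :=
  ewensMean_nonneg hθ fun σ => by split_ifs <;> norm_num

lemma hasSum_ewensMean (θ : ℝ) {n : ℕ} {F : ℕ → Equiv.Perm (Fin n) → ℝ}
    {G : Equiv.Perm (Fin n) → ℝ} (h : ∀ σ, HasSum (fun k => F k σ) (G σ)) :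
    HasSum (fun k => ewensMean θ n (F k)) (ewensMean θ n G) :=
  (hasSum_sum fun σ _ => (h σ).mul_left (θ ^ numCycles σ)).div_const (risingFactorial θ n)

lemma hasSum_mul_pointProb (θ : ℝ) (b : ℕ → ℕ → ℕ) (n : ℕ) (g : ℕ → ℝ) :
    HasSum (fun k => g k * pointProb θ b n k) (ewensMean θ n (fun σ => g (additiveFun b n σ))) := by
  simp only [pointProb, ← ewensMean_const_mul]
  refine hasSum_ewensMean θ fun σ => ?_
  have := hasSum_single (f := fun k => g k * if additiveFun b n σ = k then 1 else 0)
    (additiveFun b n σ) fun k hk => by rw [if_neg hk.symm, mul_zero]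
  simpa using this

lemma pointProb_le {θ : ℝ} (hθ : 0 < θ) (b : ℕ → ℕ → ℕ) (n k : ℕ) {z : ℝ} (hz : 0 < z) :
    pointProb θ b n k ≤ (z ^ k)⁻¹ * ewensMean θ n (fun σ => z ^ additiveFun b n σ) := by
  rw [← ewensMean_const_mul]
  refine ewensMean_mono hθ fun σ => ?_
  split_ifs with h
  · rw [h, inv_mul_cancel₀ (by positivity)]
  · positivity

/-- Coefficient of `X ^ k` in `X ^ h = ((X - 1) + 1) ^ h`. The finite sum is stated as a series so
that, after averaging, its range of summation does not depend on `n`. -/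
lemma hasSum_alternating_choose (h k : ℕ) :
    HasSum (fun l : ℕ => (-1 : ℝ) ^ (l + k) * l.choose k * h.choose l)
      (if h = k then 1 else 0) := by
  have h1 : ((Polynomial.X : Polynomial ℝ) ^ h).coeff k = if h = k then 1 else 0 := by
    rw [Polynomial.coeff_X_pow]
    simp only [eq_comm]
  have h2 : (Polynomial.X : Polynomial ℝ) ^ h = ∑ l ∈ Finset.range (h + 1),
      (Polynomial.X + Polynomial.C (-1)) ^ l * Polynomial.C (h.choose l : ℝ) := by
    conv_lhs => rw [show (Polynomial.X : Polynomial ℝ) =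
      (Polynomial.X + Polynomial.C (-1)) + 1 by simp]
    rw [add_pow]
    simp
  rw [← h1, h2, Polynomial.finsetSum_coeff]
  have h3 : ∀ l, ((Polynomial.X + Polynomial.C (-1 : ℝ)) ^ l *
      Polynomial.C (h.choose l : ℝ)).coeff k = (-1 : ℝ) ^ (l + k) * l.choose k * h.choose l := by
    intro l
    rw [Polynomial.coeff_mul_C, Polynomial.coeff_X_add_C_pow]
    rcases Nat.lt_or_ge l k with hlk | hlk
    · simp [Nat.choose_eq_zero_of_lt hlk]
    · rw [show l + k = (l - k) + 2 * k by omega, pow_add, pow_mul]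
      simp
  simp only [h3]
  refine hasSum_sum_of_ne_finset_zero fun l hl => ?_
  rw [Finset.mem_range] at hl
  rw [Nat.choose_eq_zero_of_lt (n := h) (by omega), Nat.cast_zero, mul_zero]

/-- Inversion of the factorial moments. -/
lemma hasSum_pointProb (θ : ℝ) (b : ℕ → ℕ → ℕ) (n k : ℕ) :
    HasSum (fun l : ℕ => (-1 : ℝ) ^ (l + k) * l.choose k *
      ewensMean θ n (fun σ => ((additiveFun b n σ).choose l : ℝ))) (pointProb θ b n k) := by
  simp only [← ewensMean_const_mul]
  exact hasSum_ewensMean θ fun σ => hasSum_alternating_choose _ k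

lemma summable_geometric_half_mul (C : ℝ) : Summable fun k : ℕ => C * (1 / 2 : ℝ) ^ k :=
  summable_geometric_two.mul_left C

/-- Convergence of point probabilities implies convergence of factorial moments when the supports
are bounded. -/
lemma tendsto_ewensMean_choose {θ : ℝ} (hθ : 0 < θ) {b : ℕ → ℕ → ℕ} {K : ℕ}
    (hb : ∀ n j, b n j ≤ K) {B : ℝ} (hB : ∀ᶠ n in atTop, suppSum (b n) n ≤ B) {p : ℕ → ℝ}
    (hp : ∀ k, Tendsto (fun n => pointProb θ b n k) atTop (𝓝 (p k))) (l : ℕ) :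
    Summable (fun k : ℕ => |(k.choose l : ℝ) * p k|) ∧
      Tendsto (fun n => ewensMean θ n (fun σ => ((additiveFun b n σ).choose l : ℝ)))
        atTop (𝓝 (∑' k : ℕ, (k.choose l : ℝ) * p k)) := by
  -- The base `4` beats `k.choose l ≤ 2 ^ k` and leaves the summable bound `C * (1 / 2) ^ k`.
  obtain ⟨C, hC, h⟩ := exists_ewensMean_pow_le hθ (show (1 : ℝ) ≤ 4 by norm_num) K B
  have hbound : ∀ᶠ n in atTop, ∀ k : ℕ,
      ‖(k.choose l : ℝ) * pointProb θ b n k‖ ≤ C * (1 / 2 : ℝ) ^ k := by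
    filter_upwards [hB, eventually_ge_atTop 1] with n hBn hn k
    have hP := (pointProb_le hθ b n k (show (0 : ℝ) < 4 by norm_num)).trans
      (mul_le_mul_of_nonneg_left (h b n (hb n) hn hBn) (by positivity))
    rw [Real.norm_eq_abs, abs_of_nonneg (mul_nonneg (by positivity) (pointProb_nonneg hθ b n k))]
    have hc : (k.choose l : ℝ) ≤ 2 ^ k := by exact_mod_cast Nat.choose_le_two_pow k l
    calc (k.choose l : ℝ) * pointProb θ b n k ≤ 2 ^ k * ((4 ^ k)⁻¹ * C) :=
          mul_le_mul hc hP (pointProb_nonneg hθ b n k) (by positivity)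
      _ = C * (1 / 2 : ℝ) ^ k := by
          rw [show (4 : ℝ) = 2 * 2 by norm_num, mul_pow, one_div, inv_pow]
          field_simp
  have hlim : ∀ k : ℕ, Tendsto (fun n => (k.choose l : ℝ) * pointProb θ b n k) atTop
      (𝓝 ((k.choose l : ℝ) * p k)) := fun k => (hp k).const_mul _
  refine ⟨Summable.of_nonneg_of_le (fun k => abs_nonneg _) (fun k => ?_)
    (summable_geometric_half_mul C), ?_⟩
  · exact le_of_tendsto (hlim k).norm (hbound.mono fun n hn => hn k)
  · have := tendsto_tsum_of_dominated_convergence (summable_geometric_half_mul C) hlim hbound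
    refine this.congr fun n => ?_
    exact (hasSum_mul_pointProb θ b n fun k => (k.choose l : ℝ)).tsum_eq

/-- Convergence of factorial moments implies convergence of point probabilities when the supports
are bounded. -/
lemma tendsto_pointProb {θ : ℝ} (hθ : 0 < θ) {b : ℕ → ℕ → ℕ} {K : ℕ}
    (hb : ∀ n j, b n j ≤ K) {B : ℝ} (hB : ∀ᶠ n in atTop, suppSum (b n) n ≤ B) {q : ℕ → ℝ}
    (hq : ∀ l, Tendsto (fun n => ewensMean θ n (fun σ => ((additiveFun b n σ).choose l : ℝ)))
      atTop (𝓝 (q l))) (k : ℕ) :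
    Tendsto (fun n => pointProb θ b n k) atTop
      (𝓝 (∑' l : ℕ, (-1 : ℝ) ^ (l + k) * l.choose k * q l)) := by
  -- With `t = 4` in `ewensMean_choose_le` the moments are at most `C * 4 ^ (-l)`, which beats
  -- `l.choose k ≤ 2 ^ l`.
  obtain ⟨C, hC, h⟩ := exists_ewensMean_pow_le hθ (show (1 : ℝ) ≤ 4 + 1 by norm_num) K B
  have hbound : ∀ᶠ n in atTop, ∀ l : ℕ, ‖(-1 : ℝ) ^ (l + k) * l.choose k *
      ewensMean θ n (fun σ => ((additiveFun b n σ).choose l : ℝ))‖ ≤ C * (1 / 2 : ℝ) ^ l := by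
    filter_upwards [hB, eventually_ge_atTop 1] with n hBn hn l
    have hM := (ewensMean_choose_le hθ b n l (show (0 : ℝ) < 4 by norm_num)).trans
      (mul_le_mul_of_nonneg_left (h b n (hb n) hn hBn) (by positivity))
    have hM0 : 0 ≤ ewensMean θ n (fun σ => ((additiveFun b n σ).choose l : ℝ)) :=
      ewensMean_nonneg hθ fun σ => by positivity
    rw [norm_mul, norm_mul, norm_pow, norm_neg, norm_one, one_pow, one_mul, Real.norm_natCast,
      Real.norm_of_nonneg hM0]
    have hc : (l.choose k : ℝ) ≤ 2 ^ l := by exact_mod_cast Nat.choose_le_two_pow l k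
    calc (l.choose k : ℝ) * ewensMean θ n (fun σ => ((additiveFun b n σ).choose l : ℝ))
        ≤ 2 ^ l * ((4 ^ l)⁻¹ * C) := mul_le_mul hc hM hM0 (by positivity)
      _ = C * (1 / 2 : ℝ) ^ l := by
          rw [show (4 : ℝ) = 2 * 2 by norm_num, mul_pow, one_div, inv_pow]
          field_simp
  have := tendsto_tsum_of_dominated_convergence (summable_geometric_half_mul C)
    (fun l => (hq l).const_mul ((-1 : ℝ) ^ (l + k) * l.choose k)) hbound
  exact this.congr fun n => (hasSum_pointProb θ b n k).tsum_eq

/-- The two functions differ only where some cycle has `a ≥ K`; by Markov's inequality that event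
has probability at most the mean number of such cycles. -/
lemma tendsto_pointProb_sub_truncArray {θ : ℝ} (hθ : 0 < θ) {a : ℕ → ℕ → ℕ} {K : ℕ}
    (hlarge : Tendsto (fun n => ewensMean θ n (fun σ => (additiveFun (largeArray a K) n σ : ℝ)))
      atTop (𝓝 0)) (k : ℕ) :
    Tendsto (fun n => pointProb θ a n k - pointProb θ (truncArray a K) n k) atTop (𝓝 0) := by
  have key : ∀ (c d : ℕ → ℕ → ℕ), (∀ n (σ : Equiv.Perm (Fin n)),
      additiveFun (largeArray a K) n σ = 0 → additiveFun c n σ = additiveFun d n σ) →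
      ∀ n, pointProb θ c n k ≤ pointProb θ d n k +
        ewensMean θ n (fun σ => (additiveFun (largeArray a K) n σ : ℝ)) := by
    intro c d hcd n
    rw [pointProb, pointProb, ← ewensMean_add]
    refine ewensMean_mono hθ fun σ => ?_
    rcases Nat.eq_zero_or_pos (additiveFun (largeArray a K) n σ) with h | h
    · rw [hcd n σ h, h]
      simp
    · have h' : (1 : ℝ) ≤ additiveFun (largeArray a K) n σ := by exact_mod_cast h
      split_ifs <;> linarith
  refine squeeze_zero_norm (fun n => ?_) hlarge
  rw [Real.norm_eq_abs, abs_sub_le_iff]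
  constructor
  · linarith [key a (truncArray a K) (fun n σ h => (additiveFun_truncArray_eq h).symm) n]
  · linarith [key (truncArray a K) a (fun n σ h => additiveFun_truncArray_eq h) n]

end PointProbabilities

/-! ### Weak convergence on the nonnegative integers. -/

section WeakConvergence

lemma natCast_lt_iff_of_mem_Ioo {k j : ℕ} {y : ℝ} (hy : y ∈ Set.Ioo ((k : ℝ) - 1) k) :
    (j : ℝ) < y ↔ j < k := by
  constructor
  · intro h
    exact_mod_cast h.trans hy.2
  · intro h
    have : (j : ℝ) + 1 ≤ k := by exact_mod_cast h
    linarith [hy.1]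

lemma sub_half_mem_Ioo (k : ℕ) : (k : ℝ) - 1 / 2 ∈ Set.Ioo ((k : ℝ) - 1) k := by
  constructor <;> linarith

lemma lawDistFun_eq (μ : Measure ℕ) {k : ℕ} {y : ℝ} (hy : y ∈ Set.Ioo ((k : ℝ) - 1) k) :
    lawDistFun μ y = μ.real {j | j < k} := by
  simp only [lawDistFun, natCast_lt_iff_of_mem_Ioo hy]

lemma continuousAt_lawDistFun (μ : Measure ℕ) (k : ℕ) :
    ContinuousAt (lawDistFun μ) ((k : ℝ) - 1 / 2) := by
  refine (continuousAt_const (y := μ.real {j | j < k})).congr ?_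
  filter_upwards [isOpen_Ioo.mem_nhds (sub_half_mem_Ioo k)] with y hy
  exact (lawDistFun_eq μ hy).symm

lemma distFun_eq_sum_pointProb (θ : ℝ) (a : ℕ → ℕ → ℕ) (n : ℕ) (x : ℝ) :
    distFun θ a n x = ∑ k ∈ Finset.range ⌈x⌉₊, pointProb θ a n k := by
  simp only [pointProb]
  rw [distFun, ewensProb_eq_ewensMean, ← ewensMean_sum]
  congr 1
  funext σ
  rw [Finset.sum_ite_eq]
  simp [Set.indicator_apply, Nat.lt_ceil]

lemma lawDistFun_eq_sum (μ : Measure ℕ) [IsFiniteMeasure μ] (x : ℝ) :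
    lawDistFun μ x = ∑ k ∈ Finset.range ⌈x⌉₊, μ.real {k} := by
  rw [sum_measureReal_singleton, lawDistFun]
  congr 1
  ext k
  simp [Nat.lt_ceil]

lemma natCeil_sub_half (k : ℕ) : ⌈(k : ℝ) - 1 / 2⌉₊ = k := by
  refine le_antisymm (Nat.ceil_le.2 (by linarith)) ?_
  by_contra h
  have h1 := (natCast_lt_iff_of_mem_Ioo (sub_half_mem_Ioo k)).2 (not_le.1 h)
  exact absurd (Nat.le_ceil ((k : ℝ) - 1 / 2)) (not_le.2 h1)

lemma weakConv_of_tendsto_pointProb {θ : ℝ} {a : ℕ → ℕ → ℕ} {μ : Measure ℕ} [IsFiniteMeasure μ]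
    (h : ∀ k, Tendsto (fun n => pointProb θ a n k) atTop (𝓝 (μ.real {k}))) :
    WeakConv (distFun θ a) (lawDistFun μ) := by
  intro x _
  simp only [distFun_eq_sum_pointProb, lawDistFun_eq_sum]
  exact tendsto_finsetSum _ fun k _ => h k

/-- The mass at `k` is the increment of the distribution function between the continuity points `k -
1 / 2` and `k + 1 / 2`. -/
lemma tendsto_pointProb_of_weakConv {θ : ℝ} {a : ℕ → ℕ → ℕ} {μ : Measure ℕ} [IsFiniteMeasure μ]
    (h : WeakConv (distFun θ a) (lawDistFun μ)) (k : ℕ) :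
    Tendsto (fun n => pointProb θ a n k) atTop (𝓝 (μ.real {k})) := by
  have h1 := (h _ (continuousAt_lawDistFun μ (k + 1))).sub (h _ (continuousAt_lawDistFun μ k))
  simpa only [distFun_eq_sum_pointProb, lawDistFun_eq_sum, natCeil_sub_half,
    Finset.sum_range_succ, add_sub_cancel_left] using h1

/-- Weak convergence bounds the size of the support. -/
lemma exists_suppSum_le_of_weakConv {θ : ℝ} (hθ : 0 < θ) {a : ℕ → ℕ → ℕ} {μ : Measure ℕ}
    [IsProbabilityMeasure μ] (h : WeakConv (distFun θ a) (lawDistFun μ)) :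
    ∃ B : ℝ, ∀ᶠ n in atTop, suppSum (a n) n ≤ B := by
  obtain ⟨C, hC, hmean⟩ := exists_ewensMean_half_pow_le hθ
  have htail : Tendsto (fun k : ℕ => μ.real {j | j < k}) atTop (𝓝 1) := by
    have h1 := tendsto_measure_iUnion_atTop (μ := μ) (s := fun k : ℕ => {j | j < k})
      fun i j hij x hx => lt_of_lt_of_le hx hij
    have h2 : (⋃ k : ℕ, {j | j < k}) = Set.univ :=
      Set.eq_univ_of_forall fun j => Set.mem_iUnion.2 ⟨j + 1, Nat.lt_succ_self j⟩
    rw [h2, measure_univ] at h1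
    exact (ENNReal.tendsto_toReal ENNReal.one_ne_top).comp h1
  -- With `μ {j | j < k} > 1 / 2`, eventually `1 / 2 < P(h_n < k) ≤ 2 ^ k E 2 ^ (-h_n)`, and the
  -- last mean decays exponentially in the support sum.
  obtain ⟨k, hk⟩ := (htail.eventually_const_lt (show (1 / 2 : ℝ) < 1 by norm_num)).exists
  have hT := h _ (continuousAt_lawDistFun μ k)
  rw [lawDistFun_eq μ (sub_half_mem_Ioo k)] at hT
  refine ⟨2 / θ * Real.log (2 * (2 ^ k * C)), ?_⟩
  filter_upwards [hT.eventually_const_lt hk, eventually_ge_atTop 1] with n hn hn1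
  have h1 : distFun θ a n ((k : ℝ) - 1 / 2) ≤
      2 ^ k * ewensMean θ n (fun σ => (1 / 2 : ℝ) ^ additiveFun a n σ) := by
    rw [distFun, ewensProb_eq_ewensMean, ← ewensMean_const_mul]
    refine ewensMean_mono hθ fun σ => ?_
    simp only [Set.indicator_apply, Set.mem_ofPred_eq,
      natCast_lt_iff_of_mem_Ioo (sub_half_mem_Ioo k), Pi.one_apply]
    split_ifs with hσ
    · calc (1 : ℝ) = 2 ^ k * (1 / 2) ^ k := by rw [← mul_pow]; norm_num
        _ ≤ 2 ^ k * (1 / 2) ^ additiveFun a n σ :=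
          mul_le_mul_of_nonneg_left
            (pow_le_pow_of_le_one (by norm_num) (by norm_num) hσ.le) (by positivity)
    · positivity
  have h2 := mul_le_mul_of_nonneg_left (hmean a n hn1) (show (0 : ℝ) ≤ 2 ^ k by positivity)
  have h3 : Real.exp (θ / 2 * suppSum (a n) n) ≤ 2 * (2 ^ k * C) := by
    have h4 : (1 / 2 : ℝ) < 2 ^ k * (C * Real.exp (-(θ / 2 * suppSum (a n) n))) := by linarith
    rw [Real.exp_neg, ← mul_assoc, ← div_eq_mul_inv, lt_div_iff₀ (Real.exp_pos _)] at h4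
    linarith
  have h5 := (Real.le_log_iff_exp_le (by positivity)).2 h3
  rw [div_mul_eq_mul_div, le_div_iff₀ hθ]
  linarith

end WeakConvergence

/-! ### The two implications and the moment identity. -/

lemma suppSum_truncArray (a : ℕ → ℕ → ℕ) {K : ℕ} (hK : 1 ≤ K) (n : ℕ) :
    suppSum (truncArray a K n) n = suppSum (a n) n := by
  simp only [suppSum, truncArray, le_min_iff, hK, and_true]

lemma Upsilon_eq (θ : ℝ) (a : ℕ → ℕ → ℕ) (n K : ℕ) {l : ℕ} (hl : 1 ≤ l) :
    Upsilon θ a n l K = l.factorial * ∑ m ∈ Finset.range n,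
      factCoeff θ (truncArray a K n) l m * (1 - (m : ℝ) / n) ^ (θ - 1) :=
  Upsilon_eq_sum_factCoeff θ a n K hl

lemma tendsto_Upsilon_of_weakConv {θ : ℝ} (hθ : 0 < θ) {a : ℕ → ℕ → ℕ} {K : ℕ} (hK : 1 ≤ K)
    (hlarge : Tendsto (fun n => ewensMean θ n (fun σ => (additiveFun (largeArray a K) n σ : ℝ)))
      atTop (𝓝 0)) {μ : Measure ℕ} [IsProbabilityMeasure μ]
    (h : WeakConv (distFun θ a) (lawDistFun μ)) {l : ℕ} (hl : 1 ≤ l) :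
    Integrable (fun k : ℕ => (k.descFactorial l : ℝ)) μ ∧
      Tendsto (fun n => Upsilon θ a n l K) atTop (𝓝 (∫ k : ℕ, (k.descFactorial l : ℝ) ∂μ)) := by
  obtain ⟨B, hB⟩ := exists_suppSum_le_of_weakConv hθ h
  have hB' : ∀ᶠ n in atTop, suppSum (truncArray a K n) n ≤ B :=
    hB.mono fun n hn => (suppSum_truncArray a hK n).trans_le hn
  have hb : ∀ n j, truncArray a K n j ≤ K := fun n j => min_le_right _ _
  have hp : ∀ k, Tendsto (fun n => pointProb θ (truncArray a K) n k) atTop (𝓝 (μ.real {k})) := by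
    intro k
    have := (tendsto_pointProb_of_weakConv h k).sub (tendsto_pointProb_sub_truncArray hθ hlarge k)
    simpa using this
  obtain ⟨hs, ht⟩ := tendsto_ewensMean_choose hθ hb hB' hp l
  have hdesc : ∀ k : ℕ, (k.descFactorial l : ℝ) = l.factorial * k.choose l := fun k => by
    rw [Nat.descFactorial_eq_factorial_mul_choose]
    push_cast
    rfl
  have hint : Integrable (fun k : ℕ => (k.descFactorial l : ℝ)) μ := by
    rw [← Measure.sum_smul_dirac μ]
    refine integrable_sum_dirac (fun k => measure_ne_top _ _) ?_
    refine (hs.mul_left (l.factorial : ℝ)).congr fun k => ?_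
    rw [Real.norm_natCast, hdesc, abs_of_nonneg (mul_nonneg (by positivity) measureReal_nonneg),
      measureReal_def]
    ring
  refine ⟨hint, ?_⟩
  have hval : ∫ k : ℕ, (k.descFactorial l : ℝ) ∂μ =
      l.factorial * ∑' k : ℕ, (k.choose l : ℝ) * μ.real {k} := by
    rw [integral_countable hint, ← tsum_mul_left]
    refine tsum_congr fun k => ?_
    rw [smul_eq_mul, hdesc]
    ring
  -- Subtracting the vanishing difference turns the exact weights into those of `Υ_n(l)`.
  have := (ht.sub (tendsto_ewensMean_choose_sub hθ hb hB' l)).const_mul (l.factorial : ℝ)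
  simp only [sub_sub_cancel, sub_zero, ← hval, ← Upsilon_eq θ a _ K hl] at this
  exact this

lemma exists_weakConv_of_tendsto_Upsilon {θ : ℝ} (hθ : 0 < θ) {a : ℕ → ℕ → ℕ} {K : ℕ}
    (hlarge : Tendsto (fun n => ewensMean θ n (fun σ => (additiveFun (largeArray a K) n σ : ℝ)))
      atTop (𝓝 0)) {Υ : ℕ → ℝ}
    (h : ∀ l : ℕ, 1 ≤ l → Tendsto (fun n : ℕ => Upsilon θ a n l K) atTop (𝓝 (Υ l))) :
    ∃ μ : Measure ℕ, IsProbabilityMeasure μ ∧ WeakConv (distFun θ a) (lawDistFun μ) := by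
  set b := truncArray a K with hb_def
  have hb : ∀ n j, b n j ≤ K := fun n j => min_le_right _ _
  have hB : ∀ᶠ n in atTop, suppSum (b n) n ≤
      (θ * min 1 ((1 / 2 : ℝ) ^ (θ - 1)))⁻¹ * (Υ 1 + 1) + 2 := by
    filter_upwards [(h 1 le_rfl).eventually_le_const (lt_add_one (Υ 1)), eventually_ge_atTop 1]
      with n hn hn1
    rw [Upsilon_eq θ a n K le_rfl, Nat.factorial_one, Nat.cast_one, one_mul] at hn
    refine (suppSum_le hθ (b n) hn1).trans ?_
    have : 0 < min 1 ((1 / 2 : ℝ) ^ (θ - 1)) :=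
      lt_min one_pos (Real.rpow_pos_of_pos (by norm_num) _)
    gcongr
  have hq : ∀ l, ∃ q : ℝ, Tendsto
      (fun n => ewensMean θ n (fun σ => ((additiveFun b n σ).choose l : ℝ))) atTop (𝓝 q) := by
    intro l
    rcases Nat.eq_zero_or_pos l with rfl | hl
    · simp only [Nat.choose_zero_right, Nat.cast_one, ewensMean_one hθ]
      exact ⟨1, tendsto_const_nhds⟩
    · have h1 := ((h l hl).const_mul (l.factorial : ℝ)⁻¹).add
        (tendsto_ewensMean_choose_sub hθ hb hB l)
      refine ⟨_, h1.congr fun n => ?_⟩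
      rw [Upsilon_eq θ a n K hl, inv_mul_cancel_left₀ (by positivity), add_sub_cancel]
  choose q hq using hq
  have hpb := tendsto_pointProb hθ hb hB hq
  set p : ℕ → ℝ := fun k => ∑' l : ℕ, (-1 : ℝ) ^ (l + k) * l.choose k * q l with hp
  have hp0 : ∀ k, 0 ≤ p k := fun k =>
    ge_of_tendsto' (hpb k) fun n => pointProb_nonneg hθ b n k
  -- The case `l = 0` says that no mass escapes: the limits `p k` sum to `1`.
  obtain ⟨hs, ht⟩ := tendsto_ewensMean_choose hθ hb hB hpb 0
  simp only [Nat.choose_zero_right, Nat.cast_one, one_mul, ewensMean_one hθ] at hs ht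
  have hsum : Summable p := hs.of_abs
  have hsum1 : ∑' k, p k = 1 := (tendsto_nhds_unique tendsto_const_nhds ht).symm
  have hpmf : HasSum (fun k => ENNReal.ofReal (p k)) 1 := by
    have h1 := ENNReal.ofReal_tsum_of_nonneg hp0 hsum
    rw [hsum1, ENNReal.ofReal_one] at h1
    rw [h1]
    exact ENNReal.summable.hasSum
  set P : PMF ℕ := ⟨fun k => ENNReal.ofReal (p k), hpmf⟩ with hP
  refine ⟨P.toMeasure, inferInstance, weakConv_of_tendsto_pointProb fun k => ?_⟩
  have hreal : P.toMeasure.real {k} = p k := by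
    rw [measureReal_def, PMF.toMeasure_apply_singleton _ _ (measurableSet_singleton k)]
    exact ENNReal.toReal_ofReal (hp0 k)
  rw [hreal]
  have := (tendsto_pointProb_sub_truncArray hθ hlarge k).add (hpb k)
  simpa only [zero_add, sub_add_cancel, ← hb_def] using this

end EwensAdditive

end

theorem theorem3 (θ : ℝ) (hθ : 0 < θ) (a : ℕ → ℕ → ℕ) (K : ℕ) (hK : 1 ≤ K)
    (hbdd : Tendsto
      (fun n : ℕ => ∑ j ∈ Finset.Ico 1 n,
        (if K ≤ a n j then (1 : ℝ) else 0) / (j : ℝ) * (1 - (j : ℝ) / (n : ℝ)) ^ (θ - 1))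
      atTop (𝓝 0)) :
    ((∃ μ : Measure ℕ, IsProbabilityMeasure μ ∧
        EwensAdditive.WeakConv (EwensAdditive.distFun θ a) (EwensAdditive.lawDistFun μ)) ↔
      ∃ Υ : ℕ → ℝ, ∀ l : ℕ, 1 ≤ l →
        Tendsto (fun n : ℕ => EwensAdditive.Upsilon θ a n l K) atTop (𝓝 (Υ l))) ∧
    ∀ (μ : Measure ℕ) (Υ : ℕ → ℝ), IsProbabilityMeasure μ →
      EwensAdditive.WeakConv (EwensAdditive.distFun θ a) (EwensAdditive.lawDistFun μ) →
      (∀ l : ℕ, 1 ≤ l →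
        Tendsto (fun n : ℕ => EwensAdditive.Upsilon θ a n l K) atTop (𝓝 (Υ l))) →
      ∀ l : ℕ, 1 ≤ l →
        Integrable (fun k : ℕ => (k.descFactorial l : ℝ)) μ ∧
          ∫ k : ℕ, (k.descFactorial l : ℝ) ∂μ = Υ l := by
  have hlarge := EwensAdditive.tendsto_ewensMean_largeArray hθ hbdd
  refine ⟨⟨?_, ?_⟩, ?_⟩
  · rintro ⟨μ, hμ, hw⟩
    exact ⟨_, fun l hl => (EwensAdditive.tendsto_Upsilon_of_weakConv hθ hK hlarge hw hl).2⟩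
  · rintro ⟨Υ, hΥ⟩
    exact EwensAdditive.exists_weakConv_of_tendsto_Upsilon hθ hlarge hΥ
  · intro μ Υ hμ hw hΥ l hl
    obtain ⟨hint, ht⟩ := EwensAdditive.tendsto_Upsilon_of_weakConv hθ hK hlarge hw hl
    exact ⟨hint, tendsto_nhds_unique ht (hΥ l hl)⟩
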